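/- For $n\in\mathbb{N}$ let $\mathfrak g_{2n+2}$ be the complex Lie algebra with basis $X_0,\dots,X_n,Y_0,\dots,Y_n$ whose only nonzero brackets of basis vectors (up to antisymmetry) are $[Y_0,X_i]=X_i$, $[Y_0,Y_i]=-Y_i$ and $[X_i,Y_i]=X_0$ for $1\le i\le n$. Let $b_k=\dim_{\mathbb C} H^k(\mathfrak g_{2n+2},\mathbb C)$ be its $k$-th Betti number, i.e. the dimension of the $k$-th Chevalley–Eilenberg cohomology space with trivial coefficients, and put $\binom{n}{j}=0$ for $j<0$ and for $j>n$. Then for every $k\ge 0$: 1. If $k$ is even, then $$b_k=\left|\binom{n}{\frac{k}{2}}^2-\binom{n}{\frac{k-2}{2}}^2\right|.$$ 2. If $k$ is odd, then - if $k<n+1$, $\displaystyle b_k=\binom{n}{\frac{k-1}{2}}^2-\binom{n}{\frac{k-3}{2}}^2$; - if $k=n+1$, $\displaystyle b_{n+1}=2\binom{n}{\frac{n}{2}}^2-2\binom{n}{\frac{n+2}{2}}^2$; - if $k>n+1$, $\displaystyle b_k=\binom{n}{\frac{k-1}{2}}^2-\binom{n}{\frac{k+1}{2}}^2$. -/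

import Mathlib

/-! ## Cohomology of a complex Lie algebra with trivial coefficients -/

section Cohomology

variable (L : Type*) [LieRing L] [LieAlgebra ℂ L]

/-- The space `⋀ᵏ(L*)` of alternating `k`-forms on `L`. -/
abbrev LieForm (k : ℕ) : Type _ := L [⋀^Fin k]→ₗ[ℂ] ℂ

/-- The linear map sending a `(k+1)`-form `ω` to the bilinear map
`(x, y) ↦ ω([x, y], ·, …, ·)` with values in `k`-forms. -/
noncomputable def bracketInsert (k : ℕ) :
    LieForm L (k + 1) →ₗ[ℂ] L →ₗ[ℂ] L →ₗ[ℂ] LieForm L k where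
  toFun ω :=
    LinearMap.mk₂ ℂ (fun x y => ω.curryLeft ⁅x, y⁆)
      (fun x y z => by rw [add_lie, map_add])
      (fun c x y => by rw [smul_lie, map_smul])
      (fun x y z => by rw [lie_add, map_add])
      (fun c x y => by rw [lie_smul, map_smul])
  map_add' ω η := by ext; simp
  map_smul' c ω := by ext; simp

/-- The Chevalley–Eilenberg differential `⋀ᵏ(L*) → ⋀ᵏ⁺¹(L*)` for trivial coefficients: zero on
`0`-forms and
`(dω)(v₀, …, vₖ) = ∑_{p < q} (-1)^(p+q) ω([v_p, v_q], v₀, …, v̂_p, …, v̂_q, …, vₖ)` for `k ≥ 1`.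
It is written here as the full alternation, in which every pair `{p, q}` is counted twice; the
formula above is `ceDifferential_succ_apply`. -/
noncomputable def ceDifferential : (k : ℕ) → LieForm L k →ₗ[ℂ] LieForm L (k + 1)
  | 0 => 0
  | k + 1 =>
    { toFun := fun ω => (-(1 / 2 : ℂ)) • AlternatingMap.alternatizeUncurryFin
        (AlternatingMap.alternatizeUncurryFinLM ∘ₗ bracketInsert L k ω)
      map_add' := fun ω η => by
        rw [map_add, LinearMap.comp_add, AlternatingMap.alternatizeUncurryFin_add, smul_add]
      map_smul' := fun c ω => by
        rw [map_smul, LinearMap.comp_smul, AlternatingMap.alternatizeUncurryFin_smul, smul_comm]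
        rfl }

/-- The usual formula. The pair `i ≤ j` stands for the positions `p = i` and `q = j + 1`, whence the
exponent `i + j + 1`. -/
theorem ceDifferential_succ_apply (k : ℕ) (ω : LieForm L (k + 1)) (v : Fin (k + 2) → L) :
    ceDifferential L (k + 1) ω v =
      ∑ i : Fin (k + 1), ∑ j ≥ i, (-1 : ℂ) ^ ((i : ℕ) + (j : ℕ) + 1) *
        ω (Matrix.vecCons ⁅v i.castSucc, v j.succ⁆
          (j.removeNth (i.castSucc.removeNth v))) := by
  have h : ceDifferential L (k + 1) ω v = (-(1 / 2 : ℂ)) • AlternatingMap.alternatizeUncurryFin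
        (AlternatingMap.alternatizeUncurryFinLM ∘ₗ bracketInsert L k ω) v := rfl
  rw [h, AlternatingMap.alternatizeUncurryFin_alternatizeUncurryFinLM_comp_apply, Finset.smul_sum]
  refine Finset.sum_congr rfl fun i _ => ?_
  rw [Finset.smul_sum]
  refine Finset.sum_congr rfl fun j _ => ?_
  have e : ∀ x y : L, ∀ w : Fin k → L,
      bracketInsert L k ω x y w = ω (Matrix.vecCons ⁅x, y⁆ w) := fun _ _ _ => rfl
  have s : ∀ x y : L, ∀ w : Fin k → L,
      bracketInsert L k ω y x w = - ω (Matrix.vecCons ⁅x, y⁆ w) := by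
    intro x y w
    change ω.curryLeft ⁅y, x⁆ w = - ω.curryLeft ⁅x, y⁆ w
    rw [← lie_skew, map_neg, AlternatingMap.neg_apply]
  rw [s (v i.castSucc) (v j.succ), e, zsmul_eq_mul, smul_eq_mul]
  push_cast
  ring

/-- The space `Zᵏ(L, ℂ)` of `k`-cocycles. -/
noncomputable def ceCocycles (k : ℕ) : Submodule ℂ (LieForm L k) :=
  LinearMap.ker (ceDifferential L k)

/-- The space `Bᵏ(L, ℂ)` of `k`-coboundaries. -/
noncomputable def ceCoboundaries : (k : ℕ) → Submodule ℂ (LieForm L k)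
  | 0 => ⊥
  | k + 1 => LinearMap.range (ceDifferential L k)

/-- The cohomology space `Hᵏ(L, ℂ) = Zᵏ(L, ℂ) / Bᵏ(L, ℂ)`. -/
abbrev LieCohomology (k : ℕ) : Type _ :=
  ceCocycles L k ⧸ (ceCoboundaries L k).submoduleOf (ceCocycles L k)

/-- The `k`-th Betti number `bₖ(L, ℂ) = dim Hᵏ(L, ℂ)`. -/
noncomputable def lieBetti (k : ℕ) : ℕ := Module.finrank ℂ (LieCohomology L k)

end Cohomology

/-! ## The Lie algebra with basis `X₀, …, Xₙ, Y₀, …, Yₙ` -/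

/-- The underlying vector space: `u (Sum.inl i)` is the coordinate of `u` along `Xᵢ` and
`u (Sum.inr i)` its coordinate along `Yᵢ`, for `0 ≤ i ≤ n`. -/
def SolvableQuadratic (n : ℕ) : Type := Fin (n + 1) ⊕ Fin (n + 1) → ℂ

namespace SolvableQuadratic

variable {n : ℕ}

noncomputable instance : AddCommGroup (SolvableQuadratic n) :=
  inferInstanceAs (AddCommGroup (Fin (n + 1) ⊕ Fin (n + 1) → ℂ))

noncomputable instance : Module ℂ (SolvableQuadratic n) :=
  inferInstanceAs (Module ℂ (Fin (n + 1) ⊕ Fin (n + 1) → ℂ))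

/-- The basis `X₀, …, Xₙ, Y₀, …, Yₙ`. -/
noncomputable def basis (n : ℕ) :
    Module.Basis (Fin (n + 1) ⊕ Fin (n + 1)) ℂ (SolvableQuadratic n) :=
  Pi.basisFun ℂ (Fin (n + 1) ⊕ Fin (n + 1))

/-- The basis vector `Xᵢ`. -/
noncomputable def X (i : Fin (n + 1)) : SolvableQuadratic n := basis n (Sum.inl i)

/-- The basis vector `Yᵢ`. -/
noncomputable def Y (i : Fin (n + 1)) : SolvableQuadratic n := basis n (Sum.inr i)

/-- The bracket in coordinates; its values on the basis are listed below. -/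
noncomputable instance : Bracket (SolvableQuadratic n) (SolvableQuadratic n) where
  bracket u v := Sum.elim
    (Fin.cons
      (∑ i : Fin n, (u (Sum.inl i.succ) * v (Sum.inr i.succ)
        - u (Sum.inr i.succ) * v (Sum.inl i.succ)))
      (fun i : Fin n => u (Sum.inr 0) * v (Sum.inl i.succ) - u (Sum.inl i.succ) * v (Sum.inr 0)))
    (Fin.cons 0
      (fun i : Fin n => u (Sum.inr i.succ) * v (Sum.inr 0) - u (Sum.inr 0) * v (Sum.inr i.succ)))

theorem add_coord (u v : SolvableQuadratic n) (s : Fin (n + 1) ⊕ Fin (n + 1)) :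
    (u + v) s = u s + v s := rfl

theorem smul_coord (c : ℂ) (u : SolvableQuadratic n) (s : Fin (n + 1) ⊕ Fin (n + 1)) :
    (c • u) s = c * u s := rfl

theorem zero_coord (s : Fin (n + 1) ⊕ Fin (n + 1)) : (0 : SolvableQuadratic n) s = 0 := rfl

theorem neg_coord (u : SolvableQuadratic n) (s : Fin (n + 1) ⊕ Fin (n + 1)) :
    (-u) s = - u s := rfl

theorem lie_inl_zero (u v : SolvableQuadratic n) :
    ⁅u, v⁆ (Sum.inl 0) = ∑ i : Fin n, (u (Sum.inl i.succ) * v (Sum.inr i.succ)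
      - u (Sum.inr i.succ) * v (Sum.inl i.succ)) := rfl

theorem lie_inl_succ (u v : SolvableQuadratic n) (i : Fin n) :
    ⁅u, v⁆ (Sum.inl i.succ) =
      u (Sum.inr 0) * v (Sum.inl i.succ) - u (Sum.inl i.succ) * v (Sum.inr 0) := rfl

theorem lie_inr_zero (u v : SolvableQuadratic n) : ⁅u, v⁆ (Sum.inr 0) = 0 := rfl

theorem lie_inr_succ (u v : SolvableQuadratic n) (i : Fin n) :
    ⁅u, v⁆ (Sum.inr i.succ) =
      u (Sum.inr i.succ) * v (Sum.inr 0) - u (Sum.inr 0) * v (Sum.inr i.succ) := rfl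

theorem ext_coord {u v : SolvableQuadratic n} (hx₀ : u (Sum.inl 0) = v (Sum.inl 0))
    (hx : ∀ i : Fin n, u (Sum.inl i.succ) = v (Sum.inl i.succ))
    (hy₀ : u (Sum.inr 0) = v (Sum.inr 0))
    (hy : ∀ i : Fin n, u (Sum.inr i.succ) = v (Sum.inr i.succ)) : u = v := by
  funext s
  rcases s with i | i
  · exact Fin.cases hx₀ hx i
  · exact Fin.cases hy₀ hy i

noncomputable instance : LieRing (SolvableQuadratic n) where
  add_lie u v w := by
    apply ext_coord <;> intros <;>
      simp only [add_coord, lie_inl_zero, lie_inl_succ, lie_inr_zero, lie_inr_succ,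
        ← Finset.sum_add_distrib, add_zero] <;> (try refine Finset.sum_congr rfl fun _ _ => ?_) <;>
      ring
  lie_add u v w := by
    apply ext_coord <;> intros <;>
      simp only [add_coord, lie_inl_zero, lie_inl_succ, lie_inr_zero, lie_inr_succ,
        ← Finset.sum_add_distrib, add_zero] <;> (try refine Finset.sum_congr rfl fun _ _ => ?_) <;>
      ring
  lie_self u := by
    apply ext_coord <;> intros <;>
      simp only [zero_coord, lie_inl_zero, lie_inl_succ, lie_inr_zero, lie_inr_succ] <;>
      (try refine Finset.sum_eq_zero fun _ _ => ?_) <;> ring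
  leibniz_lie u v w := by
    apply ext_coord <;> intros <;>
      simp only [add_coord, lie_inl_zero, lie_inl_succ, lie_inr_zero, lie_inr_succ,
        ← Finset.sum_add_distrib, add_zero] <;> (try refine Finset.sum_congr rfl fun _ _ => ?_) <;>
      ring

noncomputable instance : LieAlgebra ℂ (SolvableQuadratic n) where
  lie_smul c u v := by
    apply ext_coord <;> intros <;>
      simp only [smul_coord, lie_inl_zero, lie_inl_succ, lie_inr_zero, lie_inr_succ,
        Finset.mul_sum, mul_zero] <;> (try refine Finset.sum_congr rfl fun _ _ => ?_) <;>
      ring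

/-! The brackets of basis vectors; below, `i.succ` with `i : Fin n` runs through `1, …, n`. -/

theorem X_inl (i j : Fin (n + 1)) : X i (Sum.inl j) = if j = i then 1 else 0 := by
  change (Pi.basisFun ℂ (Fin (n + 1) ⊕ Fin (n + 1))) (Sum.inl i) (Sum.inl j) = _
  rw [Pi.basisFun_apply]
  simp [Pi.single_apply]

theorem X_inr (i j : Fin (n + 1)) : X i (Sum.inr j) = 0 := by
  change (Pi.basisFun ℂ (Fin (n + 1) ⊕ Fin (n + 1))) (Sum.inl i) (Sum.inr j) = _
  rw [Pi.basisFun_apply]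
  simp

theorem Y_inl (i j : Fin (n + 1)) : Y i (Sum.inl j) = 0 := by
  change (Pi.basisFun ℂ (Fin (n + 1) ⊕ Fin (n + 1))) (Sum.inr i) (Sum.inl j) = _
  rw [Pi.basisFun_apply]
  simp

theorem Y_inr (i j : Fin (n + 1)) : Y i (Sum.inr j) = if j = i then 1 else 0 := by
  change (Pi.basisFun ℂ (Fin (n + 1) ⊕ Fin (n + 1))) (Sum.inr i) (Sum.inr j) = _
  rw [Pi.basisFun_apply]
  simp [Pi.single_apply]

theorem lie_Y_zero_X_succ (i : Fin n) : ⁅(Y 0 : SolvableQuadratic n), X i.succ⁆ = X i.succ := by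
  apply ext_coord <;> intros <;>
    simp [lie_inl_zero, lie_inl_succ, lie_inr_zero, lie_inr_succ, X_inl, X_inr, Y_inl, Y_inr,
      Fin.succ_ne_zero, (Fin.succ_ne_zero _).symm]

theorem lie_Y_zero_Y_succ (i : Fin n) : ⁅(Y 0 : SolvableQuadratic n), Y i.succ⁆ = -Y i.succ := by
  apply ext_coord <;> intros <;>
    simp [lie_inl_zero, lie_inl_succ, lie_inr_zero, lie_inr_succ, Y_inl, Y_inr,
      neg_coord, Fin.succ_ne_zero, (Fin.succ_ne_zero _).symm]

theorem lie_X_succ_Y_succ (i j : Fin n) :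
    ⁅(X i.succ : SolvableQuadratic n), Y j.succ⁆ = if j = i then X 0 else 0 := by
  split_ifs with h <;> apply ext_coord <;> intros <;>
    simp [lie_inl_zero, lie_inl_succ, lie_inr_zero, lie_inr_succ, X_inl, X_inr, Y_inl, Y_inr,
      zero_coord, h, (Fin.succ_ne_zero _).symm]

theorem lie_X_X (i j : Fin (n + 1)) : ⁅(X i : SolvableQuadratic n), X j⁆ = 0 := by
  apply ext_coord <;> intros <;>
    simp [lie_inl_zero, lie_inl_succ, lie_inr_zero, lie_inr_succ, X_inl, X_inr, zero_coord]

theorem lie_Y_succ_Y_succ (i j : Fin n) : ⁅(Y i.succ : SolvableQuadratic n), Y j.succ⁆ = 0 := by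
  apply ext_coord <;> intros <;>
    simp [lie_inl_zero, lie_inl_succ, lie_inr_zero, lie_inr_succ, Y_inl, Y_inr, zero_coord,
      (Fin.succ_ne_zero _).symm]

theorem lie_X_zero (u : SolvableQuadratic n) : ⁅(X 0 : SolvableQuadratic n), u⁆ = 0 := by
  apply ext_coord <;> intros <;>
    simp [lie_inl_zero, lie_inl_succ, lie_inr_zero, lie_inr_succ, X_inl, X_inr, zero_coord]

end SolvableQuadratic

/-- The binomial coefficient `C(n, j)` for an integer `j`, equal to `0` when `j < 0`. -/
def intBinom (n : ℕ) (j : ℤ) : ℤ := if 0 ≤ j then (n.choose j.toNat : ℤ) else 0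

/-! A form is recorded by its values on increasing sequences of basis vectors, hence as a function
on finite subsets of the basis. Contraction and exterior multiplication become operators `ann` and
`cre` satisfying the canonical anticommutation relations. In these terms (`differential_eq_dif`) the
differential is `d = y₀ ∧ w - L ι_{X₀}`, where `w` multiplies by the weight (number of `Yᵢ` minus
number of `Xᵢ`, `i ≥ 1`) and `L` is exterior multiplication by `∑ xᵢ ∧ yᵢ`.

Cartan's formula `d ι_{Y₀} + ι_{Y₀} d = w` (`dif_homotopy`) makes every nonzero weight acyclic, so
the cohomology is that of the weight-zero forms with differential `-L ι_{X₀}`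
(`finrank_cohomology_eq`). These forms split into blocks with `p` of the `xᵢ` and `p` of the `yᵢ`,
with or without `x₀` and `y₀`; a block has dimension `C(n,p)²`. The differential removes `x₀` and
applies `L`, so only the rank of `L` from block `p` to block `p + 1` is needed.

That rank comes from hard Lefschetz. With `Λ` the contraction dual to `L`, the commutator `[Λ, L]`
is `n - 2p` on block `p` (`lef_commutator`). Hence `L` is injective for `2p < n` and surjective for
`2p ≥ n` (`finrank_map_lef_of_lt`, `finrank_map_lef_of_le`), and its rank is `C(n,p)²` or
`C(n,p+1)²`. Each Betti number is the dimension of the weight-zero forms minus the outgoing and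
incoming ranks; the case split of the theorem says on which side of the middle these two maps lie.
-/

/-! ## Creation and annihilation operators on functions of finite subsets -/

namespace Fock

open Finset

/-- The functions that vanish outside the sets satisfying `P`. -/
def supp {α : Type*} (P : Finset α → Prop) : Submodule ℂ (Finset α → ℂ) where
  carrier := {f | ∀ S, ¬ P S → f S = 0}
  add_mem' hf hg S hS := by simp [hf S hS, hg S hS]
  zero_mem' S _ := rfl
  smul_mem' c f hf S hS := by simp [hf S hS]

theorem finrank_supp {α : Type*} [Fintype α] (P : Finset α → Prop) [DecidablePred P] :
    Module.finrank ℂ (supp P) = #{S | P S} := by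
  let φ : supp P ≃ₗ[ℂ] ({S // P S} → ℂ) :=
    { toFun := fun f S => f.1 S.1
      map_add' := fun _ _ => rfl
      map_smul' := fun _ _ => rfl
      invFun := fun g => ⟨fun S => if h : P S then g ⟨S, h⟩ else 0, fun S hS => by simp [hS]⟩
      left_inv := fun f => by
        ext S
        by_cases h : P S
        · simp [h]
        · simp [h, f.2 S h]
      right_inv := fun g => by ext S; simp [S.2] }
  rw [φ.finrank_eq, Module.finrank_fintype_fun_eq_card, Fintype.card_subtype]

variable {σ : Type*} [LinearOrder σ]

/-- The sign `(-1)^m`, where `m` is the number of elements of `S` smaller than `i`. -/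
noncomputable def sgn (i : σ) (S : Finset σ) : ℂ := (-1) ^ #{j ∈ S | j < i}

theorem sgn_mul_self (i : σ) (S : Finset σ) : sgn i S * sgn i S = 1 := by
  rw [sgn, ← mul_pow]; simp

theorem sgn_insert {i j : σ} {S : Finset σ} (hj : j ∉ S) :
    sgn i (insert j S) = (if j < i then -1 else 1) * sgn i S := by
  unfold sgn
  rw [filter_insert]
  split_ifs
  · rw [card_insert_of_notMem (by simp [hj]), pow_succ]; ring
  · simp

theorem sgn_erase {i j : σ} {S : Finset σ} (hj : j ∈ S) :
    sgn i (S.erase j) = (if j < i then -1 else 1) * sgn i S := by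
  conv_rhs => rw [← insert_erase hj, sgn_insert (notMem_erase j S)]
  split_ifs <;> ring

/-- The annihilation operator, contraction with the `i`-th basis vector. -/
noncomputable def ann (i : σ) : Module.End ℂ (Finset σ → ℂ) where
  toFun f S := if i ∈ S then 0 else sgn i S * f (insert i S)
  map_add' f g := by ext S; simp only [Pi.add_apply]; split_ifs <;> ring
  map_smul' c f := by
    ext S; simp only [Pi.smul_apply, smul_eq_mul, RingHom.id_apply]; split_ifs <;> ring

/-- The creation operator, exterior multiplication by the `i`-th coordinate form. -/
noncomputable def cre (i : σ) : Module.End ℂ (Finset σ → ℂ) where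
  toFun f S := if i ∈ S then sgn i S * f (S.erase i) else 0
  map_add' f g := by ext S; simp only [Pi.add_apply]; split_ifs <;> ring
  map_smul' c f := by
    ext S; simp only [Pi.smul_apply, smul_eq_mul, RingHom.id_apply]; split_ifs <;> ring

theorem ann_apply (i : σ) (f : Finset σ → ℂ) (S : Finset σ) :
    ann i f S = if i ∈ S then 0 else sgn i S * f (insert i S) := rfl

theorem cre_apply (i : σ) (f : Finset σ → ℂ) (S : Finset σ) :
    cre i f S = if i ∈ S then sgn i S * f (S.erase i) else 0 := rfl

theorem ann_mul_self (i : σ) : ann i * ann i = 0 := by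
  ext1 f; funext S
  simp [Module.End.mul_apply, ann_apply]

theorem cre_mul_self (i : σ) : cre i * cre i = 0 := by
  ext1 f; funext S
  simp [Module.End.mul_apply, cre_apply]

/-- Two distinct order comparisons give opposite signs. -/
theorem sign_swap {i j : σ} (h : i ≠ j) :
    (if i < j then (-1 : ℂ) else 1) = -(if j < i then (-1 : ℂ) else 1) := by
  rcases lt_or_gt_of_ne h with h | h <;> simp [h, h.not_gt]

theorem ann_mul_ann (i j : σ) : ann i * ann j = -(ann j * ann i) := by
  rcases eq_or_ne i j with rfl | h
  · simp [ann_mul_self]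
  ext1 f; funext S
  simp only [Module.End.mul_apply, ann_apply, LinearMap.neg_apply, Pi.neg_apply, mem_insert, h,
    h.symm, false_or]
  by_cases hi : i ∈ S <;> by_cases hj : j ∈ S <;> simp only [hi, hj, if_true, if_false, mul_zero,
    neg_zero]
  rw [sgn_insert hi, sgn_insert hj, sign_swap h, insert_comm]
  ring

theorem cre_mul_cre (i j : σ) : cre i * cre j = -(cre j * cre i) := by
  rcases eq_or_ne i j with rfl | h
  · simp [cre_mul_self]
  ext1 f; funext S
  simp only [Module.End.mul_apply, cre_apply, LinearMap.neg_apply, Pi.neg_apply, mem_erase, h,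
    h.symm, ne_eq, not_false_eq_true, true_and]
  by_cases hi : i ∈ S <;> by_cases hj : j ∈ S <;> simp only [hi, hj, if_true, if_false, mul_zero,
    neg_zero]
  rw [sgn_erase hi, sgn_erase hj, sign_swap h, erase_right_comm]
  ring

theorem cre_ann_apply (i : σ) (f : Finset σ → ℂ) (S : Finset σ) :
    (cre i * ann i) f S = if i ∈ S then f S else 0 := by
  simp only [Module.End.mul_apply, cre_apply, ann_apply, mem_erase, ne_eq, not_true_eq_false,
    false_and, if_false]
  split_ifs with h
  · rw [insert_erase h, sgn_erase h, if_neg (lt_irrefl i), one_mul, ← mul_assoc, sgn_mul_self,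
      one_mul]
  · rfl

theorem ann_mul_cre_self (i : σ) : ann i * cre i = 1 - cre i * ann i := by
  ext1 f; funext S
  rw [LinearMap.sub_apply, Pi.sub_apply, cre_ann_apply]
  simp only [Module.End.mul_apply, cre_apply, ann_apply, mem_insert_self, if_true,
    Module.End.one_apply]
  split_ifs with h
  · simp
  · rw [erase_insert h, sgn_insert h, if_neg (lt_irrefl i), one_mul, ← mul_assoc, sgn_mul_self,
      one_mul, sub_zero]

theorem ann_mul_cre_of_ne {i j : σ} (h : i ≠ j) : ann i * cre j = -(cre j * ann i) := by
  ext1 f; funext S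
  simp only [Module.End.mul_apply, cre_apply, ann_apply, LinearMap.neg_apply, Pi.neg_apply,
    mem_insert, mem_erase, h, h.symm, ne_eq, not_false_eq_true, true_and, false_or]
  by_cases hi : i ∈ S <;> by_cases hj : j ∈ S <;> simp only [hi, hj, if_true, if_false, mul_zero,
    neg_zero]
  rw [sgn_insert hi, sgn_erase hj, sign_swap h, erase_insert_of_ne h]
  ring

theorem ann_mul_cre (i j : σ) :
    ann i * cre j = (if i = j then 1 else 0) - cre j * ann i := by
  split_ifs with h
  · subst h; exact ann_mul_cre_self i
  · rw [ann_mul_cre_of_ne h, zero_sub]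

theorem ann_mem_supp {P Q : Finset σ → Prop} {i : σ}
    (h : ∀ S, i ∉ S → P (insert i S) → Q S) {f : Finset σ → ℂ} (hf : f ∈ supp P) :
    ann i f ∈ supp Q := by
  intro S hS
  rw [ann_apply]
  split_ifs with hi
  · rfl
  · rw [hf _ fun hP => hS (h S hi hP), mul_zero]

theorem cre_mem_supp {P Q : Finset σ → Prop} {i : σ}
    (h : ∀ S, i ∈ S → P (S.erase i) → Q S) {f : Finset σ → ℂ} (hf : f ∈ supp P) :
    cre i f ∈ supp Q := by
  intro S hS
  rw [cre_apply]
  split_ifs with hi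
  · rw [hf _ fun hP => hS (h S hi hP), mul_zero]
  · rfl

/-- On functions supported away from `i`, `cre i` is a right inverse of `ann i`, so the image is
everything the support condition allows. -/
theorem map_ann_supp (i : σ) (P : Finset σ → Prop) :
    (supp P).map (ann i) = supp (fun S => i ∉ S ∧ P (insert i S)) := by
  refine le_antisymm ?_ fun f hf => ?_
  · rintro _ ⟨f, hf, rfl⟩
    exact ann_mem_supp (fun S hi hP => ⟨hi, hP⟩) hf
  · refine ⟨cre i f, cre_mem_supp (fun S hi hS => by simpa [insert_erase hi] using hS) hf, ?_⟩
    rw [← Module.End.mul_apply, ann_mul_cre_self, LinearMap.sub_apply, Module.End.one_apply,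
      sub_eq_self]
    funext S
    rw [cre_ann_apply]
    split_ifs with hi
    · exact hf S fun h => h.1 hi
    · rfl

/-- A function annihilated by every `ann i` is concentrated on the empty set. -/
theorem eq_zero_of_ann {f : Finset σ → ℂ} (h : ∀ i, ann i f = 0) (h0 : f ∅ = 0) : f = 0 := by
  funext S
  rcases S.eq_empty_or_nonempty with rfl | ⟨i, hi⟩
  · exact h0
  · have := congrFun (h i) (S.erase i)
    rw [ann_apply, if_neg (notMem_erase i S), insert_erase hi] at this
    have h2 := sgn_mul_self i (S.erase i)
    rcases mul_eq_zero.1 this with h1 | h1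
    · simp [h1] at h2
    · exact h1

end Fock

/-! ## Alternating forms in coordinates -/

/-- The antiderivation rule for contraction: the first summand of the alternation has `v` in the
distinguished slot, and in the others `v` stays inside the form at the cost of one sign. -/
theorem AlternatingMap.curryLeft_alternatizeUncurryFin {R M N : Type*} [CommRing R]
    [AddCommGroup M] [AddCommGroup N] [Module R M] [Module R N] {k : ℕ}
    (f : M →ₗ[R] M [⋀^Fin (k + 1)]→ₗ[R] N) (v : M) :
    (AlternatingMap.alternatizeUncurryFin f).curryLeft v =
      f v - AlternatingMap.alternatizeUncurryFin
        ((AlternatingMap.curryLeftLinearMap.flip v) ∘ₗ f) := by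
  ext w
  rw [AlternatingMap.sub_apply, AlternatingMap.curryLeft_apply_apply,
    AlternatingMap.alternatizeUncurryFin_apply, AlternatingMap.alternatizeUncurryFin_apply,
    Fin.sum_univ_succ, sub_eq_add_neg, ← Finset.sum_neg_distrib]
  congr 1
  · simp [Fin.removeNth_zero]
  · refine Finset.sum_congr rfl fun i _ => ?_
    have : i.succ.removeNth (Matrix.vecCons v w) = Matrix.vecCons v (i.removeNth w) := by
      funext q
      refine Fin.cases ?_ (fun q => ?_) q <;> simp [Fin.removeNth_apply]
    rw [this]
    simp [pow_succ]

namespace Fock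

open Finset

variable {σ : Type*} [LinearOrder σ]

section Coordinates

variable {L : Type*} [AddCommGroup L] [Module ℂ L] (e : Module.Basis σ ℂ L)

/-- The values of a form of degree `k` on increasing sequences of basis vectors. -/
noncomputable def coords (k : ℕ) : (L [⋀^Fin k]→ₗ[ℂ] ℂ) →ₗ[ℂ] (Finset σ → ℂ) where
  toFun ω S := if h : #S = k then ω (e ∘ S.orderEmbOfFin h) else 0
  map_add' ω η := by ext S; by_cases h : #S = k <;> simp [h]
  map_smul' c ω := by ext S; by_cases h : #S = k <;> simp [h]

theorem coords_apply {k : ℕ} (ω : L [⋀^Fin k]→ₗ[ℂ] ℂ) {S : Finset σ} (h : #S = k) :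
    coords e k ω S = ω (e ∘ S.orderEmbOfFin h) := dif_pos h

theorem coords_mem_supp {k : ℕ} (ω : L [⋀^Fin k]→ₗ[ℂ] ℂ) :
    coords e k ω ∈ supp (fun S : Finset σ => #S = k) := fun _ h => dif_neg h

theorem erase_orderEmbOfFin {k : ℕ} {T : Finset σ} (h : #T = k + 1) (p : Fin (k + 1))
    (h' : #(T.erase (T.orderEmbOfFin h p)) = k) :
    ⇑((T.erase (T.orderEmbOfFin h p)).orderEmbOfFin h') = p.removeNth (T.orderEmbOfFin h) := by
  symm
  refine orderEmbOfFin_unique h' (fun x => ?_) ?_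
  · simp [Fin.removeNth_apply, Fin.succAbove_ne]
  · exact (T.orderEmbOfFin h).strictMono.comp (Fin.strictMono_succAbove p)

theorem sgn_orderEmbOfFin {k : ℕ} {T : Finset σ} (h : #T = k) (p : Fin k) :
    sgn (T.orderEmbOfFin h p) T = (-1) ^ (p : ℕ) := by
  have : ({j ∈ T | j < T.orderEmbOfFin h p} : Finset σ) =
      (Finset.Iio p).map (T.orderEmbOfFin h).toEmbedding := by
    ext j
    simp only [mem_filter, mem_map, mem_Iio, RelEmbedding.coe_toEmbedding]
    constructor
    · rintro ⟨hj, hlt⟩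
      obtain ⟨q, rfl⟩ : j ∈ Set.range (T.orderEmbOfFin h) := by simpa using hj
      exact ⟨q, by simpa using hlt, rfl⟩
    · rintro ⟨q, hq, rfl⟩
      exact ⟨orderEmbOfFin_mem T h q, by simpa using hq⟩
  rw [sgn, this, card_map, Fin.card_Iio]

theorem coords_curryLeft {k : ℕ} (ω : L [⋀^Fin (k + 1)]→ₗ[ℂ] ℂ) (i : σ) :
    coords e k (ω.curryLeft (e i)) = ann i (coords e (k + 1) ω) := by
  funext S
  rw [ann_apply]
  by_cases hS : #S = k
  · rw [coords_apply e _ hS, AlternatingMap.curryLeft_apply_apply]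
    split_ifs with hi
    · obtain ⟨q, hq⟩ : i ∈ Set.range (S.orderEmbOfFin hS) := by simpa using hi
      refine ω.map_eq_zero_of_eq (i := 0) (j := q.succ) _ ?_ (Fin.succ_ne_zero q).symm
      simp [hq]
    · have hT : #(insert i S) = k + 1 := by rw [card_insert_of_notMem hi, hS]
      obtain ⟨p, hp⟩ : i ∈ Set.range ((insert i S).orderEmbOfFin hT) := by simp
      have hE : (insert i S).erase ((insert i S).orderEmbOfFin hT p) = S := by
        rw [hp, erase_insert hi]
      have h1 := erase_orderEmbOfFin hT p (by rw [hE, hS])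
      have h2 : ⇑(S.orderEmbOfFin hS) = p.removeNth ((insert i S).orderEmbOfFin hT) := by
        rw [← h1]; congr!; exact hE.symm
      have hs : sgn i S = (-1) ^ (p : ℕ) := by
        rw [← sgn_orderEmbOfFin hT p, hp, sgn_insert hi, if_neg (lt_irrefl i), one_mul]
      -- Moving `e i` from the front to its sorted position `p` costs `(-1)^p`, which is exactly
      -- `sgn i S`.
      rw [coords_apply e _ hT, h2, hs, ← AlternatingMap.neg_one_pow_smul_map_insertNth ω p,
        zsmul_eq_mul]
      push_cast
      congr 2
      funext q
      refine Fin.succAboveCases p ?_ (fun q => ?_) q <;> simp [Fin.removeNth_apply, hp]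
  · rw [coords, LinearMap.coe_mk, AddHom.coe_mk, dif_neg hS]
    split_ifs with hi
    · rfl
    · rw [coords_mem_supp e ω _ (by simpa [card_insert_of_notMem hi] using hS), mul_zero]

theorem ann_coords_zero (ω : L [⋀^Fin 0]→ₗ[ℂ] ℂ) (i : σ) : ann i (coords e 0 ω) = 0 := by
  funext S
  rw [ann_apply]
  split_ifs with hi
  · rfl
  · rw [coords_mem_supp e _ (insert i S) (by simp), mul_zero]; rfl

/-- By induction on the degree: if all coordinates vanish, so do those of every contraction with a
basis vector, and a form of positive degree is determined by these contractions. -/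
theorem coords_injective (k : ℕ) : Function.Injective (coords e k) := by
  rw [← LinearMap.ker_eq_bot, LinearMap.ker_eq_bot']
  induction k with
  | zero =>
    intro ω h
    ext v
    have := congrFun h ∅
    rw [coords_apply e ω card_empty] at this
    rw [Subsingleton.elim v (e ∘ (∅ : Finset σ).orderEmbOfFin card_empty), this]
    rfl
  | succ k ih =>
    intro ω h
    have h0 : ω.curryLeft = 0 :=
      e.ext fun i => ih _ (by rw [coords_curryLeft, h, map_zero])
    ext v
    have := congrArg (fun f : L →ₗ[ℂ] L [⋀^Fin k]→ₗ[ℂ] ℂ => f (v 0) (Fin.tail v)) h0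
    simpa [Matrix.vecCons] using this

theorem range_coords (k : ℕ) :
    LinearMap.range (coords e k) = supp (fun S : Finset σ => #S = k) := by
  refine le_antisymm ?_ fun f hf => ?_
  · rintro _ ⟨ω, rfl⟩
    exact coords_mem_supp e ω
  · let φ := (e.exteriorPower k).constr ℂ (fun s => f s.1)
    refine ⟨φ.compAlternatingMap (exteriorPower.ιMulti ℂ k), ?_⟩
    funext S
    by_cases h : #S = k
    · rw [coords_apply e _ h]
      have := (e.exteriorPower k).constr_basis ℂ (fun s => f s.1) ⟨S, h⟩
      rw [exteriorPower.basis_apply] at this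
      exact this
    · rw [hf S h, coords_mem_supp e _ S h]

variable [Fintype σ]

theorem coords_alternatizeUncurryFin {k : ℕ} (f : L →ₗ[ℂ] L [⋀^Fin k]→ₗ[ℂ] ℂ) :
    coords e (k + 1) (AlternatingMap.alternatizeUncurryFin f) =
      ∑ a, cre a (coords e k (f (e a))) := by
  -- The right-hand side obeys the same antiderivation rule, by the anticommutation relations. By
  -- `eq_zero_of_ann` it then suffices to compare contractions, which is an induction on the degree.
  have hcar (k : ℕ) (f : L →ₗ[ℂ] L [⋀^Fin k]→ₗ[ℂ] ℂ) (j : σ) :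
      ann j (∑ a, cre a (coords e k (f (e a)))) =
        coords e k (f (e j)) - ∑ a, cre a (ann j (coords e k (f (e a)))) := by
    simp only [map_sum, ← Module.End.mul_apply, ann_mul_cre, LinearMap.sub_apply,
      sum_sub_distrib]
    congr 1
    rw [sum_eq_single j (fun a _ h => by simp [h.symm]) (by simp)]
    simp
  have key (k : ℕ) (f : L →ₗ[ℂ] L [⋀^Fin k]→ₗ[ℂ] ℂ)
      (h : ∀ j, ann j (coords e (k + 1) (AlternatingMap.alternatizeUncurryFin f)) =
        ann j (∑ a, cre a (coords e k (f (e a))))) :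
      coords e (k + 1) (AlternatingMap.alternatizeUncurryFin f) =
        ∑ a, cre a (coords e k (f (e a))) := by
    rw [← sub_eq_zero]
    refine eq_zero_of_ann (fun j => by rw [map_sub, h, sub_self]) ?_
    rw [Pi.sub_apply, coords_mem_supp e _ ∅ (by simp), Finset.sum_apply]
    simp [cre_apply]
  induction k with
  | zero =>
    refine key 0 f fun j => ?_
    rw [← coords_curryLeft, hcar]
    have h1 : (AlternatingMap.alternatizeUncurryFin f).curryLeft (e j) = f (e j) := by
      ext v
      simp [AlternatingMap.alternatizeUncurryFin_apply, Subsingleton.elim _ v]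
    simp [h1, ann_coords_zero]
  | succ k ih =>
    refine key (k + 1) f fun j => ?_
    rw [← coords_curryLeft, AlternatingMap.curryLeft_alternatizeUncurryFin, map_sub, ih, hcar]
    congr 1
    refine sum_congr rfl fun a _ => ?_
    rw [← coords_curryLeft]
    rfl

end Coordinates

/-! ### The Chevalley–Eilenberg complex in coordinates. -/

section Lie

variable {L : Type*} [LieRing L] [LieAlgebra ℂ L] (e : Module.Basis σ ℂ L)

/-- Contraction with a vector. -/
noncomputable def contract : L →ₗ[ℂ] Module.End ℂ (Finset σ → ℂ) := e.constr ℂ ann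

theorem contract_basis (i : σ) : contract e (e i) = ann i := e.constr_basis ℂ ann i

theorem coords_curryLeft_apply {k : ℕ} (ω : L [⋀^Fin (k + 1)]→ₗ[ℂ] ℂ) (v : L) :
    coords e k (ω.curryLeft v) = contract e v (coords e (k + 1) ω) := by
  have : coords e k ∘ₗ ω.curryLeft =
      (LinearMap.applyₗ (coords e (k + 1) ω)) ∘ₗ contract e :=
    e.ext fun i => by simp [contract_basis, coords_curryLeft]
  exact LinearMap.congr_fun this v

variable [Fintype σ]

/-- The Chevalley–Eilenberg differential in coordinates. -/
noncomputable def differential : Module.End ℂ (Finset σ → ℂ) :=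
  (-(1 / 2 : ℂ)) • ∑ a, ∑ b, cre a * (cre b * contract e ⁅e a, e b⁆)

theorem coords_ceDifferential (k : ℕ) (ω : LieForm L k) :
    coords e (k + 1) (ceDifferential L k ω) = differential e (coords e k ω) := by
  cases k with
  | zero =>
    have h : (LinearMap.applyₗ (coords e 0 ω)) ∘ₗ contract e = 0 :=
      e.ext fun i => by simp [contract_basis, ann_coords_zero]
    have h' (v : L) : contract e v (coords e 0 ω) = 0 := LinearMap.congr_fun h v
    have h0 : ceDifferential L 0 ω = 0 := rfl
    simp [h0, differential, h']
  | succ k =>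
    have h : ceDifferential L (k + 1) ω = (-(1 / 2 : ℂ)) • AlternatingMap.alternatizeUncurryFin
      (AlternatingMap.alternatizeUncurryFinLM ∘ₗ bracketInsert L k ω) := rfl
    rw [h, map_smul, coords_alternatizeUncurryFin, differential, LinearMap.smul_apply,
      LinearMap.sum_apply]
    congr 1
    refine sum_congr rfl fun a _ => ?_
    rw [LinearMap.sum_apply]
    change cre a (coords e (k + 1)
      (AlternatingMap.alternatizeUncurryFin (bracketInsert L k ω (e a)))) = _
    rw [coords_alternatizeUncurryFin, map_sum]
    refine sum_congr rfl fun b _ => ?_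
    rw [Module.End.mul_apply, Module.End.mul_apply, ← coords_curryLeft_apply]
    rfl

/-- The injection `coords` carries cocycles and coboundaries to the two spaces on the right. Writing
the lower degree as `#S + 1 = k` covers `k = 0`: no set qualifies, in agreement with the
coboundaries being zero there. -/
theorem lieBetti_eq_finrank_sub (hD : differential e * differential e = 0) (k : ℕ) :
    (lieBetti L k : ℤ) =
      Module.finrank ℂ ↥(LinearMap.ker (differential e) ⊓ supp (fun S : Finset σ => #S = k)) -
      Module.finrank ℂ ((supp (fun S : Finset σ => #S + 1 = k)).map (differential e)) := by
  have : FiniteDimensional ℂ (LieForm L k) :=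
    FiniteDimensional.of_injective _ (coords_injective e k)
  have hZ : (ceCocycles L k).map (coords e k) =
      LinearMap.ker (differential e) ⊓ supp (fun S : Finset σ => #S = k) := by
    rw [← range_coords e k]
    ext f
    constructor
    · rintro ⟨ω, hω, rfl⟩
      refine ⟨?_, ω, rfl⟩
      have hω : ceDifferential L k ω = 0 := hω
      rw [SetLike.mem_coe, LinearMap.mem_ker, ← coords_ceDifferential, hω, map_zero]
    · rintro ⟨hf, ω, rfl⟩
      refine ⟨ω, coords_injective e (k + 1) ?_, rfl⟩
      rw [coords_ceDifferential, LinearMap.mem_ker.1 hf, map_zero]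
  have hB : (ceCoboundaries L k).map (coords e k) =
      (supp (fun S : Finset σ => #S + 1 = k)).map (differential e) := by
    cases k with
    | zero =>
      have h0 : supp (fun S : Finset σ => #S + 1 = 0) = ⊥ := by
        rw [eq_bot_iff]
        exact fun f hf => funext fun S => hf S (by simp)
      rw [h0, Submodule.map_bot]
      exact Submodule.map_bot _
    | succ k =>
      simp only [Nat.add_right_cancel_iff]
      rw [← range_coords e k, LinearMap.range_eq_map, ← Submodule.map_comp]
      change (LinearMap.range (ceDifferential L k)).map _ = _
      rw [LinearMap.range_eq_map, ← Submodule.map_comp]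
      congr 1
      ext1 ω
      exact coords_ceDifferential e k ω
  have hle : ceCoboundaries L k ≤ ceCocycles L k := by
    rw [← Submodule.map_le_map_iff_of_injective (coords_injective e k), hZ, hB]
    rintro _ ⟨f, hf, rfl⟩
    refine ⟨?_, ?_⟩
    · rw [SetLike.mem_coe, LinearMap.mem_ker, ← Module.End.mul_apply, hD, LinearMap.zero_apply]
    · rw [← range_coords e k]
      have : differential e f ∈ (ceCoboundaries L k).map (coords e k) := hB ▸ ⟨f, hf, rfl⟩
      exact LinearMap.map_le_range this
  rw [← hZ, ← hB, ← (Submodule.equivMapOfInjective _ (coords_injective e k) _).finrank_eq,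
    ← (Submodule.equivMapOfInjective _ (coords_injective e k) _).finrank_eq,
    ← (Submodule.submoduleOfEquivOfLe hle).finrank_eq, lieBetti, eq_sub_iff_add_eq]
  exact_mod_cast Submodule.finrank_quotient_add_finrank _

end Lie

end Fock

/-! ## The differential of the solvable quadratic Lie algebra -/

namespace Fock

open Finset

/-! ### Enumeration of the basis by a linearly ordered index set. -/

section Index

variable {σ : Type*} {n : ℕ} (ε : Fin (n + 1) ⊕ Fin (n + 1) ≃ σ)

/-- The index of `X₀`. -/
def xZero : σ := ε (Sum.inl 0)

/-- The index of `Y₀`. -/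
def yZero : σ := ε (Sum.inr 0)

/-- The indices of `X₁, …, Xₙ`. -/
def xs : Fin n ↪ σ := ((Fin.succEmb n).trans Function.Embedding.inl).trans ε.toEmbedding

/-- The indices of `Y₁, …, Yₙ`. -/
def ys : Fin n ↪ σ := ((Fin.succEmb n).trans Function.Embedding.inr).trans ε.toEmbedding

theorem xs_apply (i : Fin n) : xs ε i = ε (Sum.inl i.succ) := rfl

theorem ys_apply (i : Fin n) : ys ε i = ε (Sum.inr i.succ) := rfl

theorem xs_ne_ys (i j : Fin n) : xs ε i ≠ ys ε j := by simp [xs_apply, ys_apply]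

theorem xs_ne_xZero (i : Fin n) : xs ε i ≠ xZero ε := by simp [xs_apply, xZero]

theorem xs_ne_yZero (i : Fin n) : xs ε i ≠ yZero ε := by simp [xs_apply, yZero]

theorem ys_ne_xZero (i : Fin n) : ys ε i ≠ xZero ε := by simp [ys_apply, xZero]

theorem ys_ne_yZero (i : Fin n) : ys ε i ≠ yZero ε := by simp [ys_apply, yZero]

theorem xZero_ne_yZero : xZero ε ≠ yZero ε := by simp [xZero, yZero]

theorem forall_index {P : σ → Prop} :
    (∀ s, P s) ↔ P (xZero ε) ∧ P (yZero ε) ∧ (∀ i, P (xs ε i)) ∧ ∀ i, P (ys ε i) := by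
  rw [← ε.forall_congr_right, Sum.forall, Fin.forall_fin_succ, Fin.forall_fin_succ]
  simp only [xs_apply, ys_apply, xZero, yZero]
  tauto

theorem sum_index [Fintype σ] {M : Type*} [AddCommMonoid M] (f : σ → M) :
    ∑ s, f s = f (xZero ε) + ∑ i, f (xs ε i) + (f (yZero ε) + ∑ i, f (ys ε i)) := by
  rw [← ε.sum_comp, Fintype.sum_sum_type, Fin.sum_univ_succ, Fin.sum_univ_succ]
  rfl

end Index

variable {σ : Type*} [LinearOrder σ]

/-- The operator of multiplication by a function. -/
noncomputable def diag {α : Type*} (φ : Finset α → ℂ) : Module.End ℂ (Finset α → ℂ) where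
  toFun f S := φ S * f S
  map_add' f g := by ext S; simp [mul_add]
  map_smul' c f := by ext S; simp [mul_left_comm]

theorem diag_apply {α : Type*} (φ f : Finset α → ℂ) (S : Finset α) : diag φ f S = φ S * f S := rfl

theorem diag_mul_diag {α : Type*} (φ ψ : Finset α → ℂ) : diag φ * diag ψ = diag (φ * ψ) := by
  ext1 f; funext S
  simp [Module.End.mul_apply, diag_apply, mul_assoc]

theorem cre_mul_diag {φ ψ : Finset σ → ℂ} {i : σ} (h : ∀ S, i ∈ S → φ (S.erase i) = ψ S) :
    cre i * diag φ = diag ψ * cre i := by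
  ext1 f; funext S
  simp only [Module.End.mul_apply, diag_apply, cre_apply]
  split_ifs with hi
  · rw [h S hi]; ring
  · simp

theorem ann_mul_diag {φ ψ : Finset σ → ℂ} {i : σ} (h : ∀ S, i ∉ S → φ (insert i S) = ψ S) :
    ann i * diag φ = diag ψ * ann i := by
  ext1 f; funext S
  simp only [Module.End.mul_apply, diag_apply, ann_apply]
  split_ifs with hi
  · simp
  · rw [h S hi]; ring

theorem end_mul_neg {α : Type*} (f g : Module.End ℂ (Finset α → ℂ)) : f * -g = -(f * g) :=
  mul_neg f g

theorem end_neg_mul {α : Type*} (f g : Module.End ℂ (Finset α → ℂ)) : -f * g = -(f * g) :=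
  neg_mul f g

/-- An odd operator commutes with a product of two odd ones; `lef` and `dualLef` are sums of such
products. -/
theorem commute_mul_of_anticommute {R : Type*} [Ring R] {a b c : R} (hb : a * b = -(b * a))
    (hc : a * c = -(c * a)) : Commute a (b * c) := by
  rw [Commute, SemiconjBy, ← mul_assoc, hb, neg_mul, mul_assoc, hc, mul_neg, neg_neg, mul_assoc]

/-- With number operators `N = a' * a` and `M = b' * b`, the two products are `(1 - N)(1 - M)` and
`N M`, whose difference is `1 - N - M`. -/
theorem pair_commutator {R : Type*} [Ring R] {a a' b b' : R} (ha : a * a' = 1 - a' * a)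
    (hb : b * b' = 1 - b' * b) (h₁ : b * a' = -(a' * b)) (h₂ : b * a = -(a * b))
    (h₃ : b' * a' = -(a' * b')) (h₄ : a * b' = -(b' * a)) :
    b * a * (a' * b') - a' * b' * (b * a) = 1 - (a' * a + b' * b) := by
  have c₁ : Commute b (a' * a) := commute_mul_of_anticommute h₁ h₂
  have c₂ : Commute b' (a' * a) := commute_mul_of_anticommute h₃ (by rw [h₄, neg_neg])
  have e₁ : b * a * (a' * b') = (1 - a' * a) * (1 - b' * b) := by
    calc _ = b * (a * a') * b' := by noncomm_ring
      _ = b * b' - b * (a' * a) * b' := by rw [ha]; noncomm_ring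
      _ = (1 - a' * a) * (b * b') := by rw [c₁.eq]; noncomm_ring
      _ = _ := by rw [hb]
  have e₂ : a' * b' * (b * a) = a' * a * (b' * b) := by
    have h₂' : a * b = -(b * a) := by rw [h₂, neg_neg]
    calc _ = a' * (b' * (b * a)) := by noncomm_ring
      _ = a' * (a * (b' * b)) := by
        rw [(commute_mul_of_anticommute h₄ h₂').eq]; noncomm_ring
      _ = _ := by noncomm_ring
  rw [e₁, e₂]; noncomm_ring

/-! ### Counting elements in a block of indices -/

section Count

variable {n : ℕ} (t : Fin n ↪ σ)

/-- The number of elements of `S` in the range of `t`. -/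
def count (S : Finset σ) : ℕ := #{i | t i ∈ S}

theorem count_insert {i : Fin n} {S : Finset σ} (h : t i ∉ S) :
    count t (insert (t i) S) = count t S + 1 := by
  have : (univ.filter fun j => t j ∈ insert (t i) S) = insert i (univ.filter fun j => t j ∈ S) := by
    ext j; simp
  rw [count, this, card_insert_of_notMem (by simpa using h), count]

theorem count_erase {i : Fin n} {S : Finset σ} (h : t i ∈ S) :
    count t (S.erase (t i)) + 1 = count t S := by
  rw [← count_insert t (notMem_erase _ S), insert_erase h]

theorem count_insert_of_ne {s : σ} (hs : ∀ i, t i ≠ s) (S : Finset σ) :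
    count t (insert s S) = count t S := by
  simp [count, hs]

theorem count_erase_of_ne {s : σ} (hs : ∀ i, t i ≠ s) (S : Finset σ) :
    count t (S.erase s) = count t S := by
  simp [count, hs]

theorem sum_cre_mul_ann : ∑ i, cre (t i) * ann (t i) = diag fun S => (count t S : ℂ) := by
  ext1 f; funext S
  rw [LinearMap.sum_apply, Finset.sum_apply, diag_apply, count]
  simp only [cre_ann_apply]
  rw [← sum_filter, sum_const, nsmul_eq_mul]

end Count

/-! ### The Lefschetz operators, the weight and the explicit differential. -/

section Blocks

variable {n : ℕ} (ε : Fin (n + 1) ⊕ Fin (n + 1) ≃ σ)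

theorem card_eq_count [Fintype σ] (S : Finset σ) :
    #S = count (xs ε) S + count (ys ε) S + (if xZero ε ∈ S then 1 else 0) +
      (if yZero ε ∈ S then 1 else 0) := by
  have : #S = ∑ s, if s ∈ S then 1 else 0 := by simp
  rw [this, sum_index ε]
  simp only [count, card_filter]
  ring

/-- Exterior multiplication by `∑ xᵢ ∧ yᵢ`. -/
noncomputable def lef : Module.End ℂ (Finset σ → ℂ) := ∑ i, cre (xs ε i) * cre (ys ε i)

/-- Contraction with `∑ Xᵢ ∧ Yᵢ`. -/
noncomputable def dualLef : Module.End ℂ (Finset σ → ℂ) := ∑ i, ann (ys ε i) * ann (xs ε i)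

/-- The weight of a basis form under the action of `Y₀`. -/
def weight (S : Finset σ) : ℤ := count (ys ε) S - count (xs ε) S

/-- The `sl₂` relation. Cross terms with `i ≠ j` commute, being even in disjoint variables; each
diagonal term contributes `1 - N_{xᵢ} - N_{yᵢ}`. -/
theorem lef_commutator :
    dualLef ε * lef ε - lef ε * dualLef ε =
      diag fun S => (n : ℂ) - (count (xs ε) S + count (ys ε) S) := by
  have hne (i j : Fin n) (h : i ≠ j) :
      ann (ys ε i) * ann (xs ε i) * (cre (xs ε j) * cre (ys ε j)) -
        cre (xs ε j) * cre (ys ε j) * (ann (ys ε i) * ann (xs ε i)) = 0 := by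
    rw [sub_eq_zero]
    have hx : xs ε i ≠ xs ε j := fun h' => h ((xs ε).injective h')
    have hy : ys ε i ≠ ys ε j := fun h' => h ((ys ε).injective h')
    exact Commute.mul_left
      (commute_mul_of_anticommute (ann_mul_cre_of_ne (xs_ne_ys ε j i).symm) (ann_mul_cre_of_ne hy))
      (commute_mul_of_anticommute (ann_mul_cre_of_ne hx) (ann_mul_cre_of_ne (xs_ne_ys ε i j)))
  have hsum : dualLef ε * lef ε - lef ε * dualLef ε =
      ∑ i, (1 - (cre (xs ε i) * ann (xs ε i) + cre (ys ε i) * ann (ys ε i))) := by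
    rw [dualLef, lef, sum_mul_sum, sum_mul_sum, sum_comm (f := fun i j => _ * (ann _ * ann _)),
      ← sum_sub_distrib]
    refine sum_congr rfl fun i _ => ?_
    rw [← sum_sub_distrib, sum_eq_single i (fun j _ hj => hne i j hj.symm) (by simp)]
    have h := xs_ne_ys ε i i
    exact pair_commutator (ann_mul_cre_self _) (ann_mul_cre_self _) (ann_mul_cre_of_ne h.symm)
      (ann_mul_ann _ _) (cre_mul_cre _ _) (ann_mul_cre_of_ne h)
  rw [hsum, sum_sub_distrib, sum_add_distrib, sum_cre_mul_ann, sum_cre_mul_ann]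
  ext1 f; funext S
  simp [diag_apply, sub_mul, add_mul]

theorem weight_erase_yZero (S : Finset σ) : weight ε (S.erase (yZero ε)) = weight ε S := by
  rw [weight, count_erase_of_ne _ (ys_ne_yZero ε), count_erase_of_ne _ (xs_ne_yZero ε), weight]

theorem weight_insert_yZero (S : Finset σ) : weight ε (insert (yZero ε) S) = weight ε S := by
  rw [weight, count_insert_of_ne _ (ys_ne_yZero ε), count_insert_of_ne _ (xs_ne_yZero ε), weight]

theorem weight_insert_xZero (S : Finset σ) : weight ε (insert (xZero ε) S) = weight ε S := by
  rw [weight, count_insert_of_ne _ (ys_ne_xZero ε), count_insert_of_ne _ (xs_ne_xZero ε), weight]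

/-- Adding one `xᵢ` and one `yᵢ` leaves the weight unchanged. The function `φ` is arbitrary because
the weight, its inverse and the indicator of weight zero all occur. -/
theorem lef_commute_diag (φ : ℤ → ℂ) : Commute (lef ε) (diag fun S => φ (weight ε S)) := by
  refine Commute.sum_left _ _ _ fun i _ => ?_
  have h1 : cre (ys ε i) * diag (fun S => φ (weight ε S)) =
      diag (fun S => φ (weight ε S - 1)) * cre (ys ε i) := by
    refine cre_mul_diag fun S hS => ?_
    rw [weight, weight, count_erase_of_ne _ (fun j => xs_ne_ys ε j i), ← count_erase _ hS]
    push_cast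
    congr 1; ring
  have h2 : cre (xs ε i) * diag (fun S => φ (weight ε S - 1)) =
      diag (fun S => φ (weight ε S)) * cre (xs ε i) := by
    refine cre_mul_diag fun S hS => ?_
    rw [weight, weight, count_erase_of_ne _ (fun j => (xs_ne_ys ε i j).symm), ← count_erase _ hS]
    push_cast
    congr 1; ring
  rw [Commute, SemiconjBy, mul_assoc, h1, ← mul_assoc, h2, mul_assoc]

theorem cre_yZero_commute_diag (φ : ℤ → ℂ) :
    Commute (cre (yZero ε)) (diag fun S => φ (weight ε S)) :=
  cre_mul_diag fun S _ => by rw [weight_erase_yZero]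

theorem ann_yZero_commute_diag (φ : ℤ → ℂ) :
    Commute (ann (yZero ε)) (diag fun S => φ (weight ε S)) :=
  ann_mul_diag fun S _ => by rw [weight_insert_yZero]

theorem ann_xZero_commute_diag (φ : ℤ → ℂ) :
    Commute (ann (xZero ε)) (diag fun S => φ (weight ε S)) :=
  ann_mul_diag fun S _ => by rw [weight_insert_xZero]

theorem cre_yZero_commute_lef : Commute (cre (yZero ε)) (lef ε) :=
  Commute.sum_right _ _ _ fun _ _ =>
    commute_mul_of_anticommute (cre_mul_cre _ _) (cre_mul_cre _ _)

theorem ann_yZero_commute_lef : Commute (ann (yZero ε)) (lef ε) :=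
  Commute.sum_right _ _ _ fun i _ => commute_mul_of_anticommute
    (ann_mul_cre_of_ne (xs_ne_yZero ε i).symm) (ann_mul_cre_of_ne (ys_ne_yZero ε i).symm)

theorem ann_xZero_commute_lef : Commute (ann (xZero ε)) (lef ε) :=
  Commute.sum_right _ _ _ fun i _ => commute_mul_of_anticommute
    (ann_mul_cre_of_ne (xs_ne_xZero ε i).symm) (ann_mul_cre_of_ne (ys_ne_xZero ε i).symm)

/-- The differential of the solvable quadratic Lie algebra in coordinates. -/
noncomputable def dif : Module.End ℂ (Finset σ → ℂ) :=
  cre (yZero ε) * diag (fun S => (weight ε S : ℂ)) - lef ε * ann (xZero ε)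

theorem dif_commute_diag (φ : ℤ → ℂ) : Commute (dif ε) (diag fun S => φ (weight ε S)) := by
  refine Commute.sub_left (Commute.mul_left (cre_yZero_commute_diag ε φ) ?_)
    (Commute.mul_left (lef_commute_diag ε φ) (ann_xZero_commute_diag ε φ))
  rw [Commute, SemiconjBy, diag_mul_diag, diag_mul_diag, mul_comm]

/-- Both summands square to zero, through `cre (yZero ε)` and `ann (xZero ε)` respectively, and they
anticommute. -/
theorem dif_mul_dif : dif ε * dif ε = 0 := by
  set w := diag fun S => (weight ε S : ℂ) with hw
  have h₁ : cre (yZero ε) * w * (cre (yZero ε) * w) = 0 := by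
    rw [mul_assoc, ← mul_assoc w, ← (cre_yZero_commute_diag ε Int.cast).eq, mul_assoc, ← mul_assoc,
      cre_mul_self, zero_mul]
  have h₂ : lef ε * ann (xZero ε) * (lef ε * ann (xZero ε)) = 0 := by
    rw [mul_assoc, ← mul_assoc (ann _), (ann_xZero_commute_lef ε).eq, mul_assoc, ann_mul_self,
      mul_zero, mul_zero]
  have h₃ : lef ε * ann (xZero ε) * (cre (yZero ε) * w) =
      -(cre (yZero ε) * w * (lef ε * ann (xZero ε))) := by
    calc _ = lef ε * (ann (xZero ε) * cre (yZero ε)) * w := by simp only [mul_assoc]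
      _ = -(lef ε * cre (yZero ε) * (ann (xZero ε) * w)) := by
        rw [ann_mul_cre_of_ne (xZero_ne_yZero ε)]; simp only [end_mul_neg, end_neg_mul, mul_assoc]
      _ = -(cre (yZero ε) * (lef ε * w) * ann (xZero ε)) := by
        rw [hw, (ann_xZero_commute_diag ε Int.cast).eq, ← (cre_yZero_commute_lef ε).eq]
        simp only [mul_assoc]
      _ = _ := by rw [hw, (lef_commute_diag ε Int.cast).eq]; simp only [mul_assoc]
  rw [dif, ← hw, sub_mul, mul_sub, mul_sub, h₁, h₂, h₃]
  simp

/-- Cartan's formula for `Y₀`. The part with `lef` anticommutes with `ann (yZero ε)` and cancels;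
the rest is the relation between `ann (yZero ε)` and `cre (yZero ε)`, times the weight. -/
theorem dif_homotopy :
    dif ε * ann (yZero ε) + ann (yZero ε) * dif ε = diag (fun S => (weight ε S : ℂ)) := by
  set w := diag fun S => (weight ε S : ℂ) with hw
  have h₁ : cre (yZero ε) * w * ann (yZero ε) = cre (yZero ε) * ann (yZero ε) * w := by
    rw [mul_assoc, ← (ann_yZero_commute_diag ε Int.cast).eq, mul_assoc]
  have h₂ : ann (yZero ε) * (lef ε * ann (xZero ε)) =
      -(lef ε * ann (xZero ε) * ann (yZero ε)) := by
    rw [← mul_assoc, (ann_yZero_commute_lef ε).eq, mul_assoc, ann_mul_ann, end_mul_neg, mul_assoc]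
  rw [dif, ← hw, sub_mul, mul_sub, h₁, h₂, ← mul_assoc, ann_mul_cre_self, sub_mul, one_mul]
  abel

/-- Each nonzero bracket occurs for both orders of its arguments, which cancels the factor `1/2`.
The brackets with `Y₀` assemble into `y₀ ∧ w`, and `[Xᵢ, Yᵢ] = X₀` into `-L ι_{X₀}`. -/
theorem differential_eq_dif [Fintype σ] :
    differential ((SolvableQuadratic.basis n).reindex ε) = dif ε := by
  set b := (SolvableQuadratic.basis n).reindex ε
  have hx₀ : b (xZero ε) = SolvableQuadratic.X 0 := by simp [b, xZero, SolvableQuadratic.X]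
  have hy₀ : b (yZero ε) = SolvableQuadratic.Y 0 := by simp [b, yZero, SolvableQuadratic.Y]
  have hx (i : Fin n) : b (xs ε i) = SolvableQuadratic.X i.succ := by
    simp [b, xs_apply, SolvableQuadratic.X]
  have hy (i : Fin n) : b (ys ε i) = SolvableQuadratic.Y i.succ := by
    simp [b, ys_apply, SolvableQuadratic.Y]
  have cx₀ : contract b (SolvableQuadratic.X 0) = ann (xZero ε) := by rw [← hx₀, contract_basis]
  have cx (i : Fin n) : contract b (SolvableQuadratic.X i.succ) = ann (xs ε i) := by
    rw [← hx, contract_basis]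
  have cy (i : Fin n) : contract b (SolvableQuadratic.Y i.succ) = ann (ys ε i) := by
    rw [← hy, contract_basis]
  have l₁ (u : SolvableQuadratic n) : ⁅u, (SolvableQuadratic.X 0 : SolvableQuadratic n)⁆ = 0 := by
    rw [← lie_skew, SolvableQuadratic.lie_X_zero, neg_zero]
  have l₂ (i : Fin n) : ⁅(SolvableQuadratic.X i.succ : SolvableQuadratic n),
      (SolvableQuadratic.Y 0 : SolvableQuadratic n)⁆ = -SolvableQuadratic.X i.succ := by
    rw [← lie_skew, SolvableQuadratic.lie_Y_zero_X_succ]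
  have l₃ (i : Fin n) : ⁅(SolvableQuadratic.Y i.succ : SolvableQuadratic n),
      (SolvableQuadratic.Y 0 : SolvableQuadratic n)⁆ = SolvableQuadratic.Y i.succ := by
    rw [← lie_skew, SolvableQuadratic.lie_Y_zero_Y_succ, neg_neg]
  have l₄ (i j : Fin n) : ⁅(SolvableQuadratic.Y j.succ : SolvableQuadratic n),
      (SolvableQuadratic.X i.succ : SolvableQuadratic n)⁆ =
        if j = i then -SolvableQuadratic.X 0 else 0 := by
    rw [← lie_skew, SolvableQuadratic.lie_X_succ_Y_succ]
    split_ifs <;> simp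
  have hw : diag (fun S => (weight ε S : ℂ)) =
      ∑ i, cre (ys ε i) * ann (ys ε i) - ∑ i, cre (xs ε i) * ann (xs ε i) := by
    rw [sum_cre_mul_ann, sum_cre_mul_ann]
    refine LinearMap.ext fun f => funext fun S => ?_
    simp [diag_apply, weight, sub_mul]
  have s₁ (i : Fin n) (z : Module.End ℂ (Finset σ → ℂ)) :
      cre (xs ε i) * (cre (yZero ε) * z) = -(cre (yZero ε) * (cre (xs ε i) * z)) := by
    rw [← mul_assoc, cre_mul_cre, end_neg_mul, mul_assoc]
  have s₂ (i : Fin n) (z : Module.End ℂ (Finset σ → ℂ)) :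
      cre (ys ε i) * (cre (yZero ε) * z) = -(cre (yZero ε) * (cre (ys ε i) * z)) := by
    rw [← mul_assoc, cre_mul_cre, end_neg_mul, mul_assoc]
  have s₃ (i : Fin n) (z : Module.End ℂ (Finset σ → ℂ)) :
      cre (ys ε i) * (cre (xs ε i) * z) = -(cre (xs ε i) * (cre (ys ε i) * z)) := by
    rw [← mul_assoc, cre_mul_cre, end_neg_mul, mul_assoc]
  rw [differential, dif, hw, lef, sum_mul, mul_sub, mul_sum, mul_sum]
  simp only [sum_index ε, hx₀, hy₀, hx, hy, SolvableQuadratic.lie_X_zero, l₁, l₂, l₃, l₄, lie_self,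
    SolvableQuadratic.lie_X_X, SolvableQuadratic.lie_Y_succ_Y_succ,
    SolvableQuadratic.lie_X_succ_Y_succ, SolvableQuadratic.lie_Y_zero_X_succ,
    SolvableQuadratic.lie_Y_zero_Y_succ, map_zero, map_neg, apply_ite (contract b), cx₀, cx, cy,
    mul_zero, sum_const_zero, add_zero, zero_add, end_mul_neg, mul_ite, sum_ite_eq, sum_ite_eq',
    mem_univ, if_true, s₁, s₂, s₃, neg_neg, sum_neg_distrib, mul_assoc, sum_add_distrib]
  module

end Blocks

end Fock

/-! ## Reduction to forms of weight zero -/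

namespace Fock

open Finset

theorem finrank_map_add_finrank_inf_ker {V W : Type*} [AddCommGroup V] [Module ℂ V]
    [FiniteDimensional ℂ V] [AddCommGroup W] [Module ℂ W] (f : V →ₗ[ℂ] W) (M : Submodule ℂ V) :
    Module.finrank ℂ (M.map f) + Module.finrank ℂ ↥(LinearMap.ker f ⊓ M) =
      Module.finrank ℂ M := by
  rw [← LinearMap.finrank_range_add_finrank_ker (f.domRestrict M), LinearMap.range_domRestrict,
    LinearMap.ker_domRestrict]
  congr 1
  rw [(Submodule.equivMapOfInjective M.subtype M.subtype_injective _).finrank_eq,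
    Submodule.map_comap_subtype, inf_comm]

theorem diag_mem_supp {α : Type*} {P : Finset α → Prop} (φ : Finset α → ℂ) {f : Finset α → ℂ}
    (hf : f ∈ supp P) : diag φ f ∈ supp P := fun S hS => by
  rw [diag_apply, hf S hS, mul_zero]

variable {σ : Type*} [LinearOrder σ] {n : ℕ} (ε : Fin (n + 1) ⊕ Fin (n + 1) ≃ σ)

theorem lef_mem_supp {P Q : Finset σ → Prop}
    (h : ∀ S i, xs ε i ∈ S → ys ε i ∈ S → P ((S.erase (xs ε i)).erase (ys ε i)) → Q S)
    {f : Finset σ → ℂ} (hf : f ∈ supp P) : lef ε f ∈ supp Q := by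
  rw [lef, LinearMap.sum_apply]
  refine Submodule.sum_mem _ fun i _ => ?_
  exact cre_mem_supp (P := fun S => ys ε i ∈ S ∧ P (S.erase (ys ε i)))
    (fun S hx hS => h S i hx (mem_of_mem_erase hS.1) hS.2)
    (cre_mem_supp (fun S hy hP => ⟨hy, hP⟩) hf)

/-- The operator induced by the differential on forms of weight zero, up to sign. -/
noncomputable def lefAnn : Module.End ℂ (Finset σ → ℂ) := lef ε * ann (xZero ε)

theorem dif_apply_of_weight_zero {f : Finset σ → ℂ}
    (hf : f ∈ supp (fun S => weight ε S = 0)) : dif ε f = -lefAnn ε f := by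
  have : diag (fun S => (weight ε S : ℂ)) f = 0 := by
    funext S
    by_cases h : weight ε S = 0
    · simp [diag_apply, h]
    · simp [diag_apply, hf S h]
  rw [dif, LinearMap.sub_apply, Module.End.mul_apply, this, map_zero, zero_sub]
  rfl

theorem dif_mem_supp {k : ℕ} {f : Finset σ → ℂ} (hf : f ∈ supp (fun S : Finset σ => #S + 1 = k)) :
    dif ε f ∈ supp (fun S : Finset σ => #S = k) := by
  refine Submodule.sub_mem _ ?_ ?_
  · refine cre_mem_supp (fun S hS hk => ?_) (diag_mem_supp _ hf)
    rw [card_erase_add_one hS] at hk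
    exact hk
  · refine lef_mem_supp ε (P := fun S => #S + 2 = k) (fun S i hx hy hk => ?_)
      (ann_mem_supp (fun S hS hk => ?_) hf)
    · have h1 : ys ε i ∈ S.erase (xs ε i) := mem_erase.2 ⟨(xs_ne_ys ε i i).symm, hy⟩
      have h2 := card_erase_add_one h1
      have h3 := card_erase_add_one hx
      omega
    · rw [card_insert_of_notMem hS] at hk
      exact hk

/-- The projection onto the forms of weight zero. -/
noncomputable def weightProj : Module.End ℂ (Finset σ → ℂ) :=
  diag fun S => (fun w : ℤ => if w = 0 then (1 : ℂ) else 0) (weight ε S)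

theorem weightProj_apply (f : Finset σ → ℂ) (S : Finset σ) :
    weightProj ε f S = if weight ε S = 0 then f S else 0 := by
  rw [weightProj, diag_apply]
  split_ifs with h <;> simp [h]

theorem dif_weightProj (f : Finset σ → ℂ) : dif ε (weightProj ε f) = weightProj ε (dif ε f) := by
  rw [← Module.End.mul_apply, ← Module.End.mul_apply, weightProj,
    (dif_commute_diag ε fun w : ℤ => if w = 0 then (1 : ℂ) else 0).eq]

theorem weightProj_mem_supp {Q : Finset σ → Prop} {f : Finset σ → ℂ} (hf : f ∈ supp Q) :
    weightProj ε f ∈ supp (fun S => Q S ∧ weight ε S = 0) := by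
  intro S hS
  rw [weightProj_apply]
  split_ifs with h
  · exact hf S fun hQ => hS ⟨hQ, h⟩
  · rfl

theorem supp_mono {α : Type*} {P Q : Finset α → Prop} (h : ∀ S, P S → Q S) : supp P ≤ supp Q :=
  fun _ hf S hS => hf S fun hP => hS (h S hP)

theorem weightProj_eq_self {f : Finset σ → ℂ} (hf : f ∈ supp (fun S => weight ε S = 0)) :
    weightProj ε f = f := by
  funext S
  rw [weightProj_apply]
  split_ifs with h
  · rfl
  · exact (hf S h).symm

/-- The projection commutes with `dif`, and on weight zero `dif` is `-lefAnn`. -/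
theorem map_weightProj_ker_dif (k : ℕ) :
    (LinearMap.ker (dif ε) ⊓ supp (fun S : Finset σ => #S = k)).map (weightProj ε) =
      LinearMap.ker (lefAnn ε) ⊓ supp (fun S => #S = k ∧ weight ε S = 0) := by
  ext f
  constructor
  · rintro ⟨z, ⟨hz, hzk⟩, rfl⟩
    have hz : dif ε z = 0 := hz
    have hk := weightProj_mem_supp ε hzk
    refine ⟨?_, hk⟩
    have := dif_apply_of_weight_zero ε (supp_mono (fun _ h => h.2) hk)
    rw [dif_weightProj, hz, map_zero, eq_comm, neg_eq_zero] at this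
    exact this
  · rintro ⟨hf, hfk⟩
    have hf : lefAnn ε f = 0 := hf
    have hw := supp_mono (fun _ h => h.2) hfk
    refine ⟨f, ⟨?_, supp_mono (fun _ h => h.1) hfk⟩, weightProj_eq_self ε hw⟩
    change dif ε f = 0
    rw [dif_apply_of_weight_zero ε hw, hf, neg_zero]

theorem map_weightProj_map_dif (Q : Finset σ → Prop) :
    ((supp Q).map (dif ε)).map (weightProj ε) =
      (supp (fun S => Q S ∧ weight ε S = 0)).map (lefAnn ε) := by
  ext f
  constructor
  · rintro ⟨_, ⟨g, hg, rfl⟩, rfl⟩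
    have hk := weightProj_mem_supp ε hg
    refine ⟨-weightProj ε g, Submodule.neg_mem _ hk, ?_⟩
    rw [← dif_weightProj, dif_apply_of_weight_zero ε (supp_mono (fun _ h => h.2) hk), map_neg]
  · rintro ⟨g, hg, rfl⟩
    have hw := supp_mono (fun _ h => h.2) hg
    refine ⟨_, ⟨-g, Submodule.neg_mem _ (supp_mono (fun _ h => h.1) hg), rfl⟩, ?_⟩
    rw [← dif_weightProj, map_neg, weightProj_eq_self ε hw, map_neg,
      dif_apply_of_weight_zero ε hw, neg_neg]

/-- Acyclicity of the nonzero weights: a cocycle without weight-zero component is a coboundary. -/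
theorem ker_weightProj_inf (k : ℕ) :
    LinearMap.ker (weightProj ε) ⊓
        (LinearMap.ker (dif ε) ⊓ supp (fun S : Finset σ => #S = k)) =
      LinearMap.ker (weightProj ε) ⊓ (supp (fun S : Finset σ => #S + 1 = k)).map (dif ε) := by
  refine le_antisymm ?_ ?_
  · rintro z ⟨hzP, hz, hzk⟩
    have hzP : weightProj ε z = 0 := hzP
    have hz : dif ε z = 0 := hz
    -- Dividing by the weight keeps a cocycle closed, so the homotopy gives `d (ι_{Y₀} v) = w v =
    -- z`. The value `0⁻¹ = 0` is harmless, since `z` vanishes in weight zero.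
    set v := diag (fun S => (fun w : ℤ => ((w : ℂ))⁻¹) (weight ε S)) z with hv
    have hdv : dif ε v = 0 := by
      have := LinearMap.congr_fun (dif_commute_diag ε (fun w : ℤ => ((w : ℂ))⁻¹)).eq z
      rw [Module.End.mul_apply, Module.End.mul_apply, hz, map_zero] at this
      exact this
    refine ⟨hzP, ann (yZero ε) v, ?_, ?_⟩
    · refine ann_mem_supp (fun S hS hk => ?_) (diag_mem_supp _ hzk)
      rw [card_insert_of_notMem hS] at hk
      exact hk
    · have h := LinearMap.congr_fun (dif_homotopy ε) v
      rw [LinearMap.add_apply, Module.End.mul_apply, Module.End.mul_apply, hdv, map_zero,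
        add_zero] at h
      rw [h]
      funext S
      rw [diag_apply, hv, diag_apply]
      by_cases hS : weight ε S = 0
      · have := congrFun hzP S
        rw [weightProj_apply, if_pos hS] at this
        simp [hS, this]
      · rw [← mul_assoc, mul_inv_cancel₀ (by exact_mod_cast hS), one_mul]
  · rintro _ ⟨hzP, g, hg, rfl⟩
    refine ⟨hzP, ?_, dif_mem_supp ε hg⟩
    change dif ε (dif ε g) = 0
    rw [← Module.End.mul_apply, dif_mul_dif, LinearMap.zero_apply]

/-- Rank–nullity for `weightProj` on cocycles and on coboundaries: the kernels coincide and cancel,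
leaving the weight-zero images. -/
theorem finrank_cohomology_eq [Fintype σ] (k : ℕ) :
    (Module.finrank ℂ ↥(LinearMap.ker (dif ε) ⊓ supp (fun S : Finset σ => #S = k)) : ℤ) -
      Module.finrank ℂ ((supp (fun S : Finset σ => #S + 1 = k)).map (dif ε)) =
    Module.finrank ℂ (supp (fun S => #S = k ∧ weight ε S = 0)) -
      Module.finrank ℂ ((supp (fun S => #S = k ∧ weight ε S = 0)).map (lefAnn ε)) -
      Module.finrank ℂ ((supp (fun S => #S + 1 = k ∧ weight ε S = 0)).map (lefAnn ε)) := by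
  rw [← finrank_map_add_finrank_inf_ker (weightProj ε)
      (LinearMap.ker (dif ε) ⊓ supp (fun S : Finset σ => #S = k)),
    ← finrank_map_add_finrank_inf_ker (weightProj ε)
      ((supp (fun S : Finset σ => #S + 1 = k)).map (dif ε)),
    ← finrank_map_add_finrank_inf_ker (lefAnn ε) (supp (fun S => #S = k ∧ weight ε S = 0)),
    map_weightProj_ker_dif, map_weightProj_map_dif, ker_weightProj_inf]
  push_cast
  ring

end Fock

/-! ## Hard Lefschetz on the blocks of weight zero -/

namespace Fock

open Finset

section Lefschetz

variable {σ : Type*} [LinearOrder σ] {n : ℕ} (ε : Fin (n + 1) ⊕ Fin (n + 1) ≃ σ)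

/-- The sets with `p` indices among `X₁, …, Xₙ`, as many among `Y₁, …, Yₙ`, and prescribed
intersection with the indices of `X₀` and `Y₀`. -/
def IsBlock (u v : Bool) (p : ℕ) (S : Finset σ) : Prop :=
  (xZero ε ∈ S ↔ u) ∧ (yZero ε ∈ S ↔ v) ∧ count (xs ε) S = p ∧ count (ys ε) S = p

instance (u v : Bool) (p : ℕ) : DecidablePred (IsBlock ε u v p) := fun _ =>
  inferInstanceAs (Decidable (_ ∧ _))

variable {ε} {u v : Bool} {p : ℕ} {f : Finset σ → ℂ}

theorem lef_mem_block (hf : f ∈ supp (IsBlock ε u v p)) :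
    lef ε f ∈ supp (IsBlock ε u v (p + 1)) := by
  refine lef_mem_supp ε (fun S i hx hy hS => ?_) hf
  have hy' : ys ε i ∈ S.erase (xs ε i) := mem_erase.2 ⟨(xs_ne_ys ε i i).symm, hy⟩
  obtain ⟨h₁, h₂, h₃, h₄⟩ := hS
  rw [count_erase_of_ne _ (fun j => xs_ne_ys ε j i)] at h₃
  have h₅ := count_erase _ hx
  have h₆ := count_erase _ hy'
  rw [count_erase_of_ne _ (fun j => (xs_ne_ys ε i j).symm)] at h₆
  simp only [mem_erase, (xs_ne_xZero ε i).symm, (ys_ne_xZero ε i).symm, (xs_ne_yZero ε i).symm,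
    (ys_ne_yZero ε i).symm, ne_eq, not_false_eq_true, true_and] at h₁ h₂
  exact ⟨h₁, h₂, by omega, by omega⟩

theorem dualLef_mem_supp {P Q : Finset σ → Prop}
    (h : ∀ S i, xs ε i ∉ S → ys ε i ∉ S → P (insert (xs ε i) (insert (ys ε i) S)) → Q S)
    (hf : f ∈ supp P) : dualLef ε f ∈ supp Q := by
  rw [dualLef, LinearMap.sum_apply]
  refine Submodule.sum_mem _ fun i _ => ?_
  exact ann_mem_supp (P := fun S => xs ε i ∉ S ∧ P (insert (xs ε i) S))
    (fun S hy hS => h S i (fun hx => hS.1 (mem_insert_of_mem hx)) hy hS.2)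
    (ann_mem_supp (fun S hx hP => ⟨hx, hP⟩) hf)

theorem IsBlock.of_insert {S : Finset σ} {i : Fin n} (hx : xs ε i ∉ S) (hy : ys ε i ∉ S)
    (hS : IsBlock ε u v p (insert (xs ε i) (insert (ys ε i) S))) :
    p ≠ 0 ∧ IsBlock ε u v (p - 1) S := by
  obtain ⟨h₁, h₂, h₃, h₄⟩ := hS
  rw [count_insert _ (by simp [hx, xs_ne_ys]), count_insert_of_ne _ (fun j => xs_ne_ys ε j i)] at h₃
  rw [count_insert_of_ne _ (fun j => (xs_ne_ys ε i j).symm), count_insert _ hy] at h₄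
  simp only [mem_insert, (xs_ne_xZero ε i).symm, (ys_ne_xZero ε i).symm, (xs_ne_yZero ε i).symm,
    (ys_ne_yZero ε i).symm, false_or] at h₁ h₂
  exact ⟨by omega, h₁, h₂, by omega, by omega⟩

theorem dualLef_mem_block (hf : f ∈ supp (IsBlock ε u v (p + 1))) :
    dualLef ε f ∈ supp (IsBlock ε u v p) :=
  dualLef_mem_supp (fun _ _ hx hy hS => (hS.of_insert hx hy).2) hf

theorem dualLef_eq_zero (hf : f ∈ supp (IsBlock ε u v 0)) : dualLef ε f = 0 := by
  have : dualLef ε f ∈ supp (fun _ => False) :=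
    dualLef_mem_supp (fun _ _ hx hy hS => (hS.of_insert hx hy).1 rfl) hf
  exact funext fun S => this S not_false

theorem eq_zero_of_mem_block (hp : n < p) (hf : f ∈ supp (IsBlock ε u v p)) : f = 0 := by
  refine funext fun S => hf S fun hS => ?_
  have : count (xs ε) S ≤ n := by
    simpa [count] using card_filter_le univ fun i => xs ε i ∈ S
  exact absurd hS.2.2.1 (by omega)

theorem dualLef_lef (hf : f ∈ supp (IsBlock ε u v p)) :
    dualLef ε (lef ε f) = lef ε (dualLef ε f) + ((n - 2 * p : ℤ) : ℂ) • f := by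
  have h := LinearMap.congr_fun (lef_commutator ε) f
  rw [LinearMap.sub_apply, Module.End.mul_apply, Module.End.mul_apply, sub_eq_iff_eq_add'] at h
  rw [h]
  congr 1
  funext S
  rw [diag_apply, Pi.smul_apply, smul_eq_mul]
  by_cases hS : IsBlock ε u v p S
  · rw [hS.2.2.1, hS.2.2.2]; push_cast; ring
  · rw [hf S hS, mul_zero, mul_zero]

/-- On the lower blocks `lef * dualLef` has no negative eigenvalue. -/
theorem eq_zero_of_lef_dualLef (hp : 2 * p ≤ n + 2) {c : ℤ} (hc : 0 < c)
    (hf : f ∈ supp (IsBlock ε u v p)) (h : lef ε (dualLef ε f) = -((c : ℂ) • f)) : f = 0 := by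
  have key {c : ℤ} {f : Finset σ → ℂ} (hc : 0 < c) (h : (0 : Finset σ → ℂ) = -((c : ℂ) • f)) :
      f = 0 := by
    rw [eq_comm, neg_eq_zero, smul_eq_zero] at h
    exact h.resolve_left (by exact_mod_cast hc.ne')
  induction p generalizing c f with
  | zero => exact key hc (by rw [← h, dualLef_eq_zero hf, map_zero])
  | succ p ih =>
    have hv := dualLef_mem_block hf
    have h' := congrArg (dualLef ε) h
    rw [dualLef_lef hv, map_neg, map_smul] at h'
    have hv0 : dualLef ε f = 0 := by
      -- Applying `dualLef` to the eigenvalue equation makes `dualLef ε f` an eigenvector one block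
      -- lower, with `c` increased by `n - 2p ≥ 0`; the descent ends at block `0`, where `dualLef`
      -- vanishes.
      refine ih (c := c + (n - 2 * p)) (by omega) (by omega) hv ?_
      rw [eq_sub_of_add_eq h']
      push_cast
      module
    exact key hc (by rw [← h, hv0, map_zero])

/-- On the upper blocks `dualLef * lef` has no negative eigenvalue. -/
theorem eq_zero_of_dualLef_lef (hp : n ≤ 2 * p + 2) {c : ℤ} (hc : 0 < c)
    (hf : f ∈ supp (IsBlock ε u v p)) (h : dualLef ε (lef ε f) = -((c : ℂ) • f)) : f = 0 := by
  -- The induction climbs, so it runs on a bound `m` for the distance to block `n + 1`, from which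
  -- point all blocks are zero.
  obtain ⟨m, hm⟩ : ∃ m, n + 1 ≤ p + m := ⟨n + 1, by omega⟩
  induction m generalizing p c f with
  | zero => exact eq_zero_of_mem_block (by omega) hf
  | succ m ih =>
    have hv := lef_mem_block hf
    have h' := congrArg (lef ε) h
    rw [← sub_eq_of_eq_add (dualLef_lef hv), map_neg, map_smul] at h'
    have hv0 : lef ε f = 0 := by
      refine ih (c := c - (n - 2 * (p + 1))) (by omega) (by omega) hv ?_ (by omega)
      rw [eq_add_of_sub_eq h']
      push_cast
      module
    rw [hv0, map_zero, eq_comm, neg_eq_zero, smul_eq_zero] at h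
    exact h.resolve_left (by exact_mod_cast hc.ne')

theorem finrank_map_lefAnn_zero (ε : Fin (n + 1) ⊕ Fin (n + 1) ≃ σ) :
    Module.finrank ℂ ((supp (fun S => #S = 0 ∧ weight ε S = 0)).map (lefAnn ε)) = 0 := by
  have : (supp (fun S => #S = 0 ∧ weight ε S = 0)).map (ann (xZero ε)) = ⊥ := by
    rw [map_ann_supp, eq_bot_iff]
    exact fun f hf => funext fun S => hf S (by simp)
  rw [lefAnn, Module.End.mul_eq_comp, Submodule.map_comp, this, Submodule.map_bot, finrank_bot]

variable [Fintype σ]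

theorem finrank_map_of_injOn {V : Type*} [AddCommGroup V] [Module ℂ V] [FiniteDimensional ℂ V]
    {g : Module.End ℂ V} {M : Submodule ℂ V} (h : ∀ x ∈ M, g x = 0 → x = 0) :
    Module.finrank ℂ (M.map g) = Module.finrank ℂ M := by
  have h0 : LinearMap.ker g ⊓ M = ⊥ := by
    rw [eq_bot_iff]
    exact fun x hx => h x hx.2 hx.1
  rw [← finrank_map_add_finrank_inf_ker g M, h0, finrank_bot, add_zero]

/-- If `lef ε f = 0`, the commutator makes `f` an eigenvector of `lef * dualLef` with eigenvalue
`-(n - 2p) < 0`, so `f = 0`. -/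
theorem finrank_map_lef_of_lt (hp : 2 * p < n) :
    Module.finrank ℂ ((supp (IsBlock ε u v p)).map (lef ε)) =
      Module.finrank ℂ (supp (IsBlock ε u v p)) := by
  refine finrank_map_of_injOn fun f hf h => ?_
  refine eq_zero_of_lef_dualLef (c := n - 2 * p) (by omega) (by omega) hf ?_
  have h' := dualLef_lef hf
  rw [h, map_zero] at h'
  exact eq_neg_of_add_eq_zero_left h'.symm

/-- Surjectivity follows from injectivity of `lef * dualLef` on block `p + 1`, whose image lies in
that of `lef`. A kernel vector would be an eigenvector of `dualLef * lef` with eigenvalue `-(2(p +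
1) - n) < 0`. -/
theorem finrank_map_lef_of_le (hp : n ≤ 2 * p) :
    Module.finrank ℂ ((supp (IsBlock ε u v p)).map (lef ε)) =
      Module.finrank ℂ (supp (IsBlock ε u v (p + 1))) := by
  refine le_antisymm (Submodule.finrank_mono ?_) ?_
  · rintro _ ⟨f, hf, rfl⟩
    exact lef_mem_block hf
  · rw [← finrank_map_of_injOn (g := lef ε * dualLef ε) (M := supp (IsBlock ε u v (p + 1)))]
    · refine Submodule.finrank_mono ?_
      rintro _ ⟨f, hf, rfl⟩
      exact ⟨_, dualLef_mem_block hf, rfl⟩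
    · intro f hf h
      refine eq_zero_of_dualLef_lef (c := 2 * (p + 1) - n) (by omega) (by omega) hf ?_
      rw [dualLef_lef hf, ← Module.End.mul_apply, h]
      push_cast
      module

/-! ### Dimensions -/

theorem finrank_block : Module.finrank ℂ (supp (IsBlock ε u v p)) = n.choose p ^ 2 := by
  have : n.choose p ^ 2 = #(powersetCard p (univ : Finset (Fin n)) ×ˢ
      powersetCard p (univ : Finset (Fin n))) := by
    rw [card_product, card_powersetCard, card_univ, Fintype.card_fin, sq]
  rw [finrank_supp, this]
  refine card_bij (fun S _ =>
    (univ.filter fun i => xs ε i ∈ S, univ.filter fun i => ys ε i ∈ S)) ?_ ?_ ?_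
  · intro S hS
    have hS : IsBlock ε u v p S := (mem_filter.1 hS).2
    exact mem_product.2 ⟨mem_powersetCard_univ.2 hS.2.2.1, mem_powersetCard_univ.2 hS.2.2.2⟩
  · intro S hS T hT h
    have hS : IsBlock ε u v p S := (mem_filter.1 hS).2
    have hT : IsBlock ε u v p T := (mem_filter.1 hT).2
    obtain ⟨h₁, h₂⟩ := Prod.mk.inj h
    rw [Finset.ext_iff, forall_index ε]
    exact ⟨hS.1.trans hT.1.symm, hS.2.1.trans hT.2.1.symm,
      fun i => by simpa using Finset.ext_iff.1 h₁ i, fun i => by simpa using Finset.ext_iff.1 h₂ i⟩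
  · rintro ⟨A, B⟩ hAB
    obtain ⟨hA, hB⟩ := mem_product.1 hAB
    let S : Finset σ := A.map (xs ε) ∪ B.map (ys ε) ∪ (if u then {xZero ε} else ∅) ∪
      (if v then {yZero ε} else ∅)
    have hx (i : Fin n) : xs ε i ∈ S ↔ i ∈ A := by
      cases u <;> cases v <;>
        simp [S, (xs_ne_ys ε _ _).symm, xs_ne_xZero, xs_ne_yZero]
    have hy (i : Fin n) : ys ε i ∈ S ↔ i ∈ B := by
      cases u <;> cases v <;> simp [S, xs_ne_ys, ys_ne_xZero, ys_ne_yZero]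
    have hx₀ : xZero ε ∈ S ↔ u := by
      cases u <;> cases v <;> simp [S, xs_ne_xZero, ys_ne_xZero, xZero_ne_yZero]
    have hy₀ : yZero ε ∈ S ↔ v := by
      cases u <;> cases v <;> simp [S, xs_ne_yZero, ys_ne_yZero, (xZero_ne_yZero ε).symm]
    refine ⟨S, mem_filter.2 ⟨mem_univ S, hx₀, hy₀, ?_, ?_⟩, ?_⟩
    · simpa [count, hx] using hA
    · simpa [count, hy] using hB
    · simp [hx, hy]

variable (ε)

/-- The rank of `lef` on a block. -/
def lefRank (n p : ℕ) : ℕ := if 2 * p < n then n.choose p ^ 2 else n.choose (p + 1) ^ 2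

theorem finrank_map_lef :
    Module.finrank ℂ ((supp (IsBlock ε u v p)).map (lef ε)) = lefRank n p := by
  rw [lefRank]
  split_ifs with h
  · rw [finrank_map_lef_of_lt h, finrank_block]
  · rw [finrank_map_lef_of_le (not_lt.1 h), finrank_block]

/-- Contraction with `X₀` maps the weight-zero forms of degree `m` onto a single block without `x₀`;
the parity of `m` decides whether `y₀` is present. -/
theorem finrank_map_lefAnn {m : ℕ} {v : Bool}
    (h : ∀ S, xZero ε ∉ S → (#S + 1 = m ∧ weight ε S = 0 ↔ IsBlock ε false v p S)) :
    Module.finrank ℂ ((supp (fun S => #S = m ∧ weight ε S = 0)).map (lefAnn ε)) =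
      lefRank n p := by
  have : (supp (fun S => #S = m ∧ weight ε S = 0)).map (ann (xZero ε)) =
      supp (IsBlock ε false v p) := by
    rw [map_ann_supp]
    congr 1
    funext S
    by_cases hS : xZero ε ∈ S
    · simp [hS, IsBlock]
    · rw [← h S hS, weight_insert_xZero, card_insert_of_notMem hS]
      simp [hS]
  rw [lefAnn, Module.End.mul_eq_comp, Submodule.map_comp, this, finrank_map_lef]

theorem finrank_map_lefAnn_odd (p : ℕ) :
    Module.finrank ℂ ((supp (fun S => #S = 2 * p + 1 ∧ weight ε S = 0)).map (lefAnn ε)) =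
      lefRank n p := by
  refine finrank_map_lefAnn ε (v := false) fun S hS => ?_
  rw [card_eq_count ε, weight, IsBlock, if_neg hS]
  by_cases hy : yZero ε ∈ S <;> simp [hS, hy] <;> omega

theorem finrank_map_lefAnn_even (p : ℕ) :
    Module.finrank ℂ ((supp (fun S => #S = 2 * p + 2 ∧ weight ε S = 0)).map (lefAnn ε)) =
      lefRank n p := by
  refine finrank_map_lefAnn ε (v := true) fun S hS => ?_
  rw [card_eq_count ε, weight, IsBlock, if_neg hS]
  by_cases hy : yZero ε ∈ S <;> simp [hS, hy] <;> omega

/-- In weight zero the `xᵢ` and `yᵢ` together contribute an even degree. So in odd degree exactly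
one of `x₀`, `y₀` occurs, and in even degree both or neither; the two resulting blocks are told
apart by `x₀`. -/
theorem finrank_weight_zero {m p q : ℕ} {u v u' v' : Bool} (huv : u ≠ u')
    (h : ∀ S, #S = m ∧ weight ε S = 0 ↔ IsBlock ε u v p S ∨ IsBlock ε u' v' q S) :
    Module.finrank ℂ (supp (fun S => #S = m ∧ weight ε S = 0)) =
      n.choose p ^ 2 + n.choose q ^ 2 := by
  rw [← finrank_block (ε := ε) (u := u) (v := v) (p := p),
    ← finrank_block (ε := ε) (u := u') (v := v') (p := q), finrank_supp, finrank_supp,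
    finrank_supp, ← card_union_of_disjoint, ← filter_or]
  · simp only [h]
  · rw [disjoint_filter]
    intro S _ h₁ h₂
    exact huv (Bool.eq_iff_iff.2 (h₁.1.symm.trans h₂.1))

theorem finrank_weight_zero_odd (p : ℕ) :
    Module.finrank ℂ (supp (fun S => #S = 2 * p + 1 ∧ weight ε S = 0)) =
      n.choose p ^ 2 + n.choose p ^ 2 := by
  refine finrank_weight_zero ε (u := true) (v := false) (u' := false) (v' := true) (by simp)
    fun S => ?_
  rw [card_eq_count ε, weight, IsBlock, IsBlock]
  by_cases hx : xZero ε ∈ S <;> by_cases hy : yZero ε ∈ S <;> simp [hx, hy] <;> omega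

theorem finrank_weight_zero_even (p : ℕ) :
    Module.finrank ℂ (supp (fun S => #S = 2 * p + 2 ∧ weight ε S = 0)) =
      n.choose (p + 1) ^ 2 + n.choose p ^ 2 := by
  refine finrank_weight_zero ε (u := false) (v := false) (u' := true) (v' := true) (by simp)
    fun S => ?_
  rw [card_eq_count ε, weight, IsBlock, IsBlock]
  by_cases hx : xZero ε ∈ S <;> by_cases hy : yZero ε ∈ S <;> simp [hx, hy] <;> omega

theorem finrank_weight_zero_zero :
    Module.finrank ℂ (supp (fun S => #S = 0 ∧ weight ε S = 0)) = 1 := by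
  rw [finrank_supp, card_eq_one]
  refine ⟨∅, ?_⟩
  ext S
  simp only [mem_filter, mem_univ, true_and, mem_singleton, card_eq_zero]
  constructor
  · exact fun h => h.1
  · rintro rfl
    simp [weight, count]

end Lefschetz

end Fock

/-! ## Betti numbers -/

namespace Fock

open Finset

theorem lieBetti_solvableQuadratic_eq {σ : Type*} [LinearOrder σ] [Fintype σ] {n : ℕ}
    (ε : Fin (n + 1) ⊕ Fin (n + 1) ≃ σ) (k : ℕ) :
    (lieBetti (SolvableQuadratic n) k : ℤ) =
      Module.finrank ℂ (supp (fun S => #S = k ∧ weight ε S = 0)) -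
      Module.finrank ℂ ((supp (fun S => #S = k ∧ weight ε S = 0)).map (lefAnn ε)) -
      Module.finrank ℂ ((supp (fun S => #S + 1 = k ∧ weight ε S = 0)).map (lefAnn ε)) := by
  rw [← finrank_cohomology_eq, ← differential_eq_dif]
  exact lieBetti_eq_finrank_sub _ (by rw [differential_eq_dif, dif_mul_dif]) k

theorem lieBetti_solvableQuadratic_succ {σ : Type*} [LinearOrder σ] [Fintype σ] {n : ℕ}
    (ε : Fin (n + 1) ⊕ Fin (n + 1) ≃ σ) (k : ℕ) :
    (lieBetti (SolvableQuadratic n) (k + 1) : ℤ) =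
      Module.finrank ℂ (supp (fun S => #S = k + 1 ∧ weight ε S = 0)) -
      Module.finrank ℂ ((supp (fun S => #S = k + 1 ∧ weight ε S = 0)).map (lefAnn ε)) -
      Module.finrank ℂ ((supp (fun S => #S = k ∧ weight ε S = 0)).map (lefAnn ε)) := by
  have h : (fun S => #S + 1 = k + 1 ∧ weight ε S = 0) = fun S => #S = k ∧ weight ε S = 0 := by
    simp only [Nat.add_right_cancel_iff]
  rw [lieBetti_solvableQuadratic_eq ε, h]

theorem lieBetti_zero (n : ℕ) : (lieBetti (SolvableQuadratic n) 0 : ℤ) = 1 := by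
  have h : supp (fun S => #S + 1 = 0 ∧ weight (n := n) finSumFinEquiv S = 0) = ⊥ := by
    rw [eq_bot_iff]
    exact fun f hf => funext fun S => hf S (by simp)
  rw [lieBetti_solvableQuadratic_eq finSumFinEquiv, finrank_weight_zero_zero,
    finrank_map_lefAnn_zero, h, Submodule.map_bot, finrank_bot]
  norm_num

theorem lieBetti_one (n : ℕ) :
    (lieBetti (SolvableQuadratic n) 1 : ℤ) = 2 * (n.choose 0 : ℤ) ^ 2 - lefRank n 0 := by
  rw [← zero_add 1, lieBetti_solvableQuadratic_succ finSumFinEquiv, finrank_map_lefAnn_zero]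
  have h₁ := finrank_weight_zero_odd (n := n) finSumFinEquiv 0
  have h₂ := finrank_map_lefAnn_odd (n := n) finSumFinEquiv 0
  rw [mul_zero] at h₁ h₂
  rw [h₁, h₂]
  push_cast
  ring

theorem lieBetti_odd (n p : ℕ) :
    (lieBetti (SolvableQuadratic n) (2 * (p + 1) + 1) : ℤ) =
      2 * (n.choose (p + 1) : ℤ) ^ 2 - lefRank n (p + 1) - lefRank n p := by
  rw [lieBetti_solvableQuadratic_succ finSumFinEquiv, finrank_weight_zero_odd,
    finrank_map_lefAnn_odd, mul_add, mul_one, finrank_map_lefAnn_even]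
  push_cast
  ring

/-- Incoming and outgoing maps are both `lef` on block `p`, without and with `y₀`, which accounts
for the factor `2`. -/
theorem lieBetti_even (n p : ℕ) :
    (lieBetti (SolvableQuadratic n) (2 * p + 2) : ℤ) =
      (n.choose (p + 1) : ℤ) ^ 2 + (n.choose p : ℤ) ^ 2 - 2 * lefRank n p := by
  rw [lieBetti_solvableQuadratic_succ finSumFinEquiv, finrank_weight_zero_even,
    finrank_map_lefAnn_even, finrank_map_lefAnn_odd]
  push_cast
  ring

theorem choose_le_choose_succ {n p : ℕ} (h : 2 * p < n) : n.choose p ≤ n.choose (p + 1) := by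
  have h₁ := Nat.choose_succ_right_eq n p
  have h₂ : n.choose p * (p + 1) ≤ n.choose p * (n - p) := Nat.mul_le_mul_left _ (by omega)
  exact Nat.le_of_mul_le_mul_right (h₁ ▸ h₂) p.succ_pos

theorem choose_succ_le_choose {n p : ℕ} (h : n ≤ 2 * p + 1) : n.choose (p + 1) ≤ n.choose p := by
  have h₁ := Nat.choose_succ_right_eq n p
  have h₂ : n.choose p * (n - p) ≤ n.choose p * (p + 1) := Nat.mul_le_mul_left _ (by omega)
  exact Nat.le_of_mul_le_mul_right (h₁ ▸ h₂) p.succ_pos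

theorem intBinom_natCast (n p : ℕ) : intBinom n p = n.choose p := by simp [intBinom]

theorem intBinom_neg {n : ℕ} {j : ℤ} (h : j < 0) : intBinom n j = 0 := if_neg (not_le.2 h)

end Fock

open Fock in
theorem theorem2 (n k : ℕ) :
    (Even k →
      (lieBetti (SolvableQuadratic n) k : ℤ) =
        |intBinom n ((k : ℤ) / 2) ^ 2 - intBinom n (((k : ℤ) - 2) / 2) ^ 2|) ∧
    (Odd k →
      (k < n + 1 →
        (lieBetti (SolvableQuadratic n) k : ℤ) =
          intBinom n (((k : ℤ) - 1) / 2) ^ 2 - intBinom n (((k : ℤ) - 3) / 2) ^ 2) ∧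
      (k = n + 1 →
        (lieBetti (SolvableQuadratic n) k : ℤ) =
          2 * intBinom n ((n : ℤ) / 2) ^ 2 - 2 * intBinom n (((n : ℤ) + 2) / 2) ^ 2) ∧
      (k > n + 1 →
        (lieBetti (SolvableQuadratic n) k : ℤ) =
          intBinom n (((k : ℤ) - 1) / 2) ^ 2 - intBinom n (((k : ℤ) + 1) / 2) ^ 2)) := by
  refine ⟨fun hk => ?_, fun hk => ?_⟩
  · obtain ⟨m, rfl⟩ := hk.exists_two_nsmul
    rw [smul_eq_mul]
    rcases m with _ | p
    · rw [mul_zero, lieBetti_zero, intBinom_neg (j := (_ - 2) / 2) (by norm_num)]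
      simp [intBinom]
    · have e₁ : ((2 * (p + 1) : ℕ) : ℤ) / 2 = (p + 1 : ℕ) := by omega
      have e₂ : (((2 * (p + 1) : ℕ) : ℤ) - 2) / 2 = (p : ℕ) := by omega
      rw [e₁, e₂, intBinom_natCast, intBinom_natCast, mul_add, mul_one, lieBetti_even, lefRank]
      split_ifs with h
      · have := choose_le_choose_succ h
        rw [abs_of_nonneg (sub_nonneg.2 (by gcongr))]
        push_cast; ring
      · have := choose_succ_le_choose (n := n) (p := p) (by omega)
        rw [abs_of_nonpos (sub_nonpos.2 (by gcongr))]
        push_cast; ring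
  · obtain ⟨m, rfl⟩ := hk
    have e₁ : (((2 * m + 1 : ℕ) : ℤ) - 1) / 2 = (m : ℕ) := by omega
    have e₂ : (((2 * m + 1 : ℕ) : ℤ) + 1) / 2 = (m + 1 : ℕ) := by omega
    rw [e₁, e₂, intBinom_natCast, intBinom_natCast]
    rcases m with _ | p
    · rw [intBinom_neg (j := _ / 2) (by norm_num), mul_zero, zero_add, lieBetti_one, lefRank]
      refine ⟨fun h => ?_, fun h => ?_, fun h => ?_⟩
      · rw [if_pos (by omega)]; simp
      -- The only middle case in degree `1`; here `lefRank 0 0 = C(0,1)² = 0` and the Betti number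
      -- is `2`.
      · obtain rfl : n = 0 := by omega
        simp [intBinom]
      · omega
    · have e₃ : (((2 * (p + 1) + 1 : ℕ) : ℤ) - 3) / 2 = (p : ℕ) := by omega
      rw [e₃, intBinom_natCast, lieBetti_odd, lefRank, lefRank]
      refine ⟨fun h => ?_, fun h => ?_, fun h => ?_⟩
      · rw [if_pos (by omega), if_pos (by omega)]
        push_cast; ring
      · have e₄ : (n : ℤ) / 2 = (p + 1 : ℕ) := by omega
        have e₅ : ((n : ℤ) + 2) / 2 = (p + 2 : ℕ) := by omega
        -- Here `n = 2p + 2`: the incoming `lef` is injective of rank `C(n,p)²`, the outgoing one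
        -- surjective of rank `C(n,p+2)²`, and symmetry makes these equal.
        have e₆ : n.choose p = n.choose (p + 2) := Nat.choose_symm_of_eq_add (by omega)
        rw [if_neg (by omega), if_pos (by omega), e₄, e₅, intBinom_natCast, intBinom_natCast, e₆]
        push_cast; ring
      · rw [if_neg (by omega)]
        split_ifs with h'
        -- The bounds `2p < n < 2p + 2` force `n = 2p + 1`, where the two central binomial
        -- coefficients coincide.
        · have e₆ : n.choose p = n.choose (p + 1) := Nat.choose_symm_of_eq_add (by omega)
          rw [e₆]; push_cast; ring
        · push_cast; ring
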